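/- Let $(\Omega,\mathcal F,\mathbb P)$ be a probability space carrying an i.i.d. sequence $\xi=\{\xi(k)\}_{k\in\mathbb Z}$ of non-negative random variables with $\lambda_1=\mathbb E[\xi(0)]\in(0,\infty)$ and $\sigma^2=\operatorname{Var}[\xi(0)]\in(0,\infty)$, $\sigma>0$. Let $a>0$ and let $b(j)\ge 0$ for $j\ge1$, not all zero. A process $X=\{X(k)\}_{k\in\mathbb Z}$ on this space is a solution of the ARCH($\infty$) equations if, almost surely, for all $k\in\mathbb Z$, $$X(k)=\varsigma(k)\,\xi(k),\qquad \varsigma(k)=a+\sum_{j=1}^\infty b(j)X(k-j),$$ with convergent series; put $\nu(k)=X(k)-\lambda_1\varsigma(k)$. Such an $X$ is weakly stationary if it has finite variances and constant mean, and $\operatorname{Cov}(X(n),X(n+k))=:\rho(k)$ does not depend on $n\in\mathbb Z$ for every $k\in\mathbb Z$. For $r>0$ let $\mathcal W(r)$ be the set of sequences $\gamma=\{\gamma(n)\}_{n\ge0}$ of positive reals such that $$\lim_{n\to\infty}\frac{\gamma(n-1)}{\gamma(n)}=\frac1r,\qquad \sum_{i=0}^\infty\gamma(i)r^{-i}<\infty,\qquad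 \lim_{m\to\infty}\Bigl(\limsup_{n\to\infty}\frac1{\gamma(n)}\sum_{i=m}^{n-m}\gamma(n-i)\gamma(i)\Bigr)=0 .$$ Here $b$ is extended by an arbitrary value $b(0)$, which must be positive if $b\in\mathcal W(r)$ but is otherwise irrelevant. **Theorem.** Fix $r\in(0,1)$. Assume that $\lambda_1\sum_{j=1}^\infty b(j)r^{-j}<1$ and that $$\frac{\sigma}{\lambda_1}\Bigl(\sum_{j=1}^\infty z(j)^2\Bigr)^{1/2}<1,\qquad\text{where}\quad \frac1{1-\lambda_1\sum_{j=1}^\infty b(j)x^j}=\sum_{j=0}^\infty z(j)x^j\quad(|x|\le 1).$$ Then the ARCH($\infty$) equations have a weakly stationary solution. If moreover $b\in\mathcal W(r)$, then for every weakly stationary solution $X$ the autocovariance function satisfies $\{\rho(n)\}_{n\ge0}\in\mathcal W(r)$, $\mathbb E[\nu(0)^2]<\infty$, and $$\lim_{n\to\infty}\frac{\rho(n)}{b(n)}=\frac{\mathbb E[\nu(0)^2]}{1-\lambda_1\sum_{j=1}^\infty b(j)r^{j}}\cdot\frac{\lambda_1}{\bigl(1-\lambda_1\sum_{j=1}^\infty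 b(j)r^{-j}\bigr)^2}.$$ -/

import Mathlib

open MeasureTheory ProbabilityTheory Filter Topology

namespace ArchInfinity

/-- The weight class `𝒲(r)` of positive real sequences. The inner `limsup` is taken in the extended
reals, so that it is `⊤` (and not a default value) when the sequence is unbounded. For `n < 2 * m`
the sum is empty. -/
structure MemW (r : ℝ) (γ : ℕ → ℝ) : Prop where
  pos : ∀ n, 0 < γ n
  ratio : Tendsto (fun n : ℕ => γ n / γ (n + 1)) atTop (𝓝 (1 / r))
  summable : Summable (fun i : ℕ => γ i * r⁻¹ ^ i)
  conv : Tendsto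
    (fun m : ℕ => limsup
      (fun n : ℕ =>
        (((1 / γ n) * ∑ i ∈ Finset.Icc m (n - m), γ (n - i) * γ i : ℝ) : EReal)) atTop)
    atTop (𝓝 0)

/-- The coefficients `z` of `1 / (1 - c * ∑_{j ≥ 1} b j * x ^ j) = ∑_{j ≥ 0} z j * x ^ j`. The value
`b 0` plays no role. -/
noncomputable def resolvent (c : ℝ) (b : ℕ → ℝ) (n : ℕ) : ℝ :=
  PowerSeries.coeff n
    ((1 - PowerSeries.mk (fun j : ℕ => if j = 0 then 0 else c * b j) : PowerSeries ℝ)⁻¹)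

/-- `Ω = (σ / λ₁) * (∑_{j ≥ 1} z j ^ 2) ^ (1 / 2)`, where `λ₁` is the mean of the shocks and `σ`
their standard deviation. -/
noncomputable def bigOmega (lam sigma : ℝ) (b : ℕ → ℝ) : ℝ :=
  sigma / lam * Real.sqrt (∑' j : ℕ, resolvent lam b (j + 1) ^ 2)

variable {Ω : Type*}

/-- The conditional volatility `ς k = a + ∑_{j ≥ 1} b j * X (k - j)`. -/
noncomputable def volatility (a : ℝ) (b : ℕ → ℝ) (X : ℤ → Ω → ℝ) (k : ℤ) (ω : Ω) : ℝ :=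
  a + ∑' j : ℕ, b (j + 1) * X (k - ((j : ℤ) + 1)) ω

/-- The innovations `ν k = X k - λ₁ * ς k`. -/
noncomputable def innovation (lam a : ℝ) (b : ℕ → ℝ) (X : ℤ → Ω → ℝ) (k : ℤ) (ω : Ω) : ℝ :=
  X k ω - lam * volatility a b X k ω

variable [MeasurableSpace Ω]

/-- The autocovariance function `ρ k = Cov(X 0, X k)` of a weakly stationary process. -/
noncomputable def autocov (P : Measure Ω) (X : ℤ → Ω → ℝ) (k : ℤ) : ℝ :=
  cov[X 0, X k; P]

/-- Weak stationarity: finite variances, constant mean, and `Cov(X n, X (n + k))` depends on `k`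
only. -/
structure IsWeaklyStationary (P : Measure Ω) (X : ℤ → Ω → ℝ) : Prop where
  measurable : ∀ k, Measurable (X k)
  memLp : ∀ k, MemLp (X k) 2 P
  mean : ∀ k, ∫ ω, X k ω ∂P = ∫ ω, X 0 ω ∂P
  cov : ∀ n k : ℤ, cov[X n, X (n + k); P] = autocov P X k

/-- The ARCH(∞) equations driven by the shocks `ξ`: almost surely, for every `k`, the series
that defines `ς k` converges and `X k = ς k * ξ k`. -/
def SolvesArch (P : Measure Ω) (ξ : ℤ → Ω → ℝ) (a : ℝ) (b : ℕ → ℝ) (X : ℤ → Ω → ℝ) : Prop :=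
  ∀ᵐ ω ∂P, ∀ k : ℤ, Summable (fun j : ℕ => b (j + 1) * X (k - ((j : ℤ) + 1)) ω) ∧
    X k ω = volatility a b X k ω * ξ k ω

/-- Shocks: independent, identically distributed, almost surely nonnegative random variables with
finite second moment, positive mean and positive variance. -/
structure IsShock (P : Measure Ω) (ξ : ℤ → Ω → ℝ) : Prop where
  measurable : ∀ k, Measurable (ξ k)
  nonneg : ∀ k, ∀ᵐ ω ∂P, 0 ≤ ξ k ω
  indep : iIndepFun ξ P
  ident : ∀ k, IdentDistrib (ξ k) (ξ 0) P P
  memLp : MemLp (ξ 0) 2 P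
  mean_pos : 0 < ∫ ω, ξ 0 ω ∂P
  variance_pos : 0 < Var[ξ 0; P]

end ArchInfinity

namespace ArchInfinity

/-! Let `z` be the resolvent of `λ₁ b`. In `X = ν + λ₁ ς` the last term is, up to the constant `λ₁
a`, the convolution of `λ₁ b` with `X`. Inverting this renewal equation turns `X(k)` into its mean
plus `∑ z j * ν(k - j)`. Since `ν(k) = (ξ(k) - λ₁) ς(k)` and `ς(k)` depends on earlier shocks only,
the innovations are centred and orthogonal, so `ρ(n) = E[ν(0)²] ∑ z j * z (j + n)`.

The inversion is purely algebraic for processes started at a finite time (`trunc_eq_mean_add`).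
These increase as the start recedes, and monotone convergence carries means, products and squared
innovations to the limit `archSol`. The second moments of the volatility satisfy a renewal
inequality with total weight `Ω²`, so `Ω < 1` keeps them bounded (`exists_volSq_le`).

For the asymptotics, `z` satisfies a renewal theorem in `𝒲(r)` (`tendsto_resolvent_div`): with `q =
λ₁ ∑ b j * r⁻¹ ^ j`, the ratio `z n / b n` tends to `λ₁ / (1 - q)²`. Dominated convergence in `∑ z j
* z (j + n) / b n` then produces the factor `∑ z j * r ^ j = 1 / (1 - λ₁ ∑ b j * r ^ j)`.

An arbitrary weakly stationary solution need not be causal, so it is first identified with `archSol`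
(`SolvesArch.ae_eq`). The difference of two solutions grows at most like `r⁻¹ ^ m` into the past,
and iterating the linear equation against such growth contracts by `q < 1` in mean. -/

/-! ### The resolvent and its generating function. -/

theorem one_sub_mul_resolvent (c : ℝ) (b : ℕ → ℝ) :
    (1 - PowerSeries.mk (fun j : ℕ => if j = 0 then 0 else c * b j) : PowerSeries ℝ) *
      PowerSeries.mk (resolvent c b) = 1 := by
  have h : PowerSeries.mk (resolvent c b) =
      (1 - PowerSeries.mk (fun j : ℕ => if j = 0 then 0 else c * b j) : PowerSeries ℝ)⁻¹ := by
    ext n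
    simp [resolvent]
  rw [h]
  apply PowerSeries.mul_inv_cancel
  rw [← PowerSeries.coeff_zero_eq_constantCoeff_apply, map_sub, PowerSeries.coeff_mk]
  simp

/-- In power series the hypothesis reads `(1 - B) * f = g`, and the resolvent is the inverse of `1 -
B`. This solves both the deterministic and the pathwise renewal equations. -/
theorem eq_of_one_sub_mul {c : ℝ} {b : ℕ → ℝ} {f g : ℕ → ℝ}
    (h : ∀ n, f n = g n + ∑ i ∈ Finset.range n, c * b (n - i) * f i) (n : ℕ) :
    f n = ∑ i ∈ Finset.range (n + 1), resolvent c b (n - i) * g i := by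
  have key : PowerSeries.mk f = PowerSeries.mk (resolvent c b) * PowerSeries.mk g := by
    have h1 : (1 - PowerSeries.mk (fun j : ℕ => if j = 0 then 0 else c * b j) : PowerSeries ℝ) *
        PowerSeries.mk f = PowerSeries.mk g := by
      ext n
      rw [sub_mul, one_mul, map_sub, mul_comm, PowerSeries.coeff_mul,
        Finset.Nat.sum_antidiagonal_eq_sum_range_succ_mk, Finset.sum_range_succ]
      simp only [PowerSeries.coeff_mk, Nat.sub_self, if_true, mul_zero, add_zero]
      rw [h n, add_sub_assoc, add_eq_left, sub_eq_zero]
      refine Finset.sum_congr rfl fun i hi => ?_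
      have := Finset.mem_range.1 hi
      rw [if_neg (by omega), mul_comm]
    calc PowerSeries.mk f = PowerSeries.mk (resolvent c b) *
          ((1 - PowerSeries.mk (fun j : ℕ => if j = 0 then 0 else c * b j) : PowerSeries ℝ) *
            PowerSeries.mk f) := by
          rw [← mul_assoc, mul_comm (PowerSeries.mk (resolvent c b)), one_sub_mul_resolvent,
            one_mul]
      _ = _ := by rw [h1]
  have := congrArg (PowerSeries.coeff n) key
  rw [mul_comm, PowerSeries.coeff_mul, Finset.Nat.sum_antidiagonal_eq_sum_range_succ_mk] at this
  simpa [mul_comm] using this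

theorem resolvent_zero (c : ℝ) (b : ℕ → ℝ) : resolvent c b 0 = 1 := by
  have := congrArg (PowerSeries.coeff 0) (one_sub_mul_resolvent c b)
  simpa [PowerSeries.coeff_mul] using this

theorem resolvent_eq (c : ℝ) (b : ℕ → ℝ) (n : ℕ) :
    resolvent c b n = (if n = 0 then 1 else 0) +
      ∑ i ∈ Finset.range n, c * b (n - i) * resolvent c b i := by
  have h1 : PowerSeries.mk (resolvent c b) = 1 +
      PowerSeries.mk (resolvent c b) *
        PowerSeries.mk (fun j : ℕ => if j = 0 then 0 else c * b j) := by
    have := one_sub_mul_resolvent c b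
    rw [sub_mul, one_mul, sub_eq_iff_eq_add] at this
    rw [mul_comm]; exact this
  have := congrArg (PowerSeries.coeff n) h1
  rw [map_add, PowerSeries.coeff_mul, Finset.Nat.sum_antidiagonal_eq_sum_range_succ_mk,
    Finset.sum_range_succ] at this
  simp only [PowerSeries.coeff_mk, Nat.sub_self, if_true, mul_zero, add_zero,
    PowerSeries.coeff_one] at this
  rw [this]
  congr 1
  refine Finset.sum_congr rfl fun i hi => ?_
  have := Finset.mem_range.1 hi
  rw [if_neg (by omega), mul_comm]

theorem resolvent_succ (c : ℝ) (b : ℕ → ℝ) (n : ℕ) :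
    resolvent c b (n + 1) =
      ∑ j ∈ Finset.range (n + 1), c * b (j + 1) * resolvent c b (n - j) := by
  rw [resolvent_eq, if_neg (by omega), zero_add, ← Finset.sum_range_reflect]
  refine Finset.sum_congr rfl fun i hi => ?_
  have := Finset.mem_range.1 hi
  rw [show n + 1 - (n + 1 - 1 - i) = i + 1 by omega, show n + 1 - 1 - i = n - i by omega]

theorem resolvent_nonneg {c : ℝ} {b : ℕ → ℝ} (hc : 0 ≤ c) (hb : ∀ j, 1 ≤ j → 0 ≤ b j) (n : ℕ) :
    0 ≤ resolvent c b n := by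
  induction n using Nat.strong_induction_on with
  | _ n ih =>
    rw [resolvent_eq]
    refine add_nonneg (by split_ifs <;> norm_num) (Finset.sum_nonneg fun i hi => ?_)
    have := Finset.mem_range.1 hi
    exact mul_nonneg (mul_nonneg hc (hb _ (by omega))) (ih i this)

theorem resolvent_pos {c : ℝ} {b : ℕ → ℝ} (hc : 0 < c) (hb : ∀ j, 0 < b j) (n : ℕ) :
    0 < resolvent c b n := by
  rcases n with _ | n
  · simp [resolvent_zero]
  · rw [resolvent_succ]
    refine lt_of_lt_of_le (b := c * b (n + 1) * resolvent c b (n - n)) ?_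
      (Finset.single_le_sum (f := fun j => c * b (j + 1) * resolvent c b (n - j))
        (fun i _ => mul_nonneg (mul_pos hc (hb _)).le
          (resolvent_nonneg hc.le (fun j _ => (hb j).le) _)) (Finset.self_mem_range_succ n))
    simpa [resolvent_zero] using mul_pos hc (hb _)

theorem hasSum_resolvent {c x : ℝ} {b : ℕ → ℝ} (hc : 0 ≤ c) (hb : ∀ j, 1 ≤ j → 0 ≤ b j)
    (hx : 0 ≤ x) (hs : Summable fun j : ℕ => b (j + 1) * x ^ (j + 1))
    (hlt : c * ∑' j : ℕ, b (j + 1) * x ^ (j + 1) < 1) :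
    HasSum (fun n => resolvent c b n * x ^ n) (1 / (1 - c * ∑' j : ℕ, b (j + 1) * x ^ (j + 1))) := by
  set q := c * ∑' j : ℕ, b (j + 1) * x ^ (j + 1) with hq
  set f : ℕ → ℝ := fun n => resolvent c b n * x ^ n with hf
  set g : ℕ → ℝ := fun j => c * (b (j + 1) * x ^ (j + 1)) with hg
  have hg0 : ∀ j, 0 ≤ g j := fun j =>
    mul_nonneg hc (mul_nonneg (hb _ (by omega)) (pow_nonneg hx _))
  have hf0 : ∀ j, 0 ≤ f j := fun j =>
    mul_nonneg (resolvent_nonneg hc hb _) (pow_nonneg hx _)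
  have hgs : Summable g := hs.mul_left c
  have hgq : ∑' j, g j = q := tsum_mul_left
  have hfs : ∀ n, f (n + 1) = ∑ j ∈ Finset.range (n + 1), g j * f (n - j) := by
    intro n
    simp only [hf, hg]
    rw [resolvent_succ, Finset.sum_mul]
    refine Finset.sum_congr rfl fun i hi => ?_
    have := Finset.mem_range.1 hi
    rw [show n + 1 = (i + 1) + (n - i) by omega, pow_add]
    ring
  have hf1 : f 0 = 1 := by simp [hf, resolvent_zero]
  have h1q : 0 < 1 - q := by linarith
  -- The partial sums satisfy `S (N + 1) ≤ 1 + q * S N`, whose fixed point is `1 / (1 - q)`.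
  -- Summability has to come first: the Cauchy product that identifies the sum needs it.
  have hbound : ∀ N, ∑ n ∈ Finset.range N, f n ≤ 1 / (1 - q) := by
    intro N
    induction N with
    | zero => simpa using (sub_pos.1 h1q).le
    | succ N ih =>
      rw [Finset.sum_range_succ', hf1, Finset.sum_congr rfl (fun n _ => hfs n),
        Finset.sum_range_diag_flip N (fun j i => g j * f i)]
      have h2 : ∑ m ∈ Finset.range N, ∑ k ∈ Finset.range (N - m), g m * f k ≤
          q * (1 / (1 - q)) := by
        calc _ ≤ ∑ m ∈ Finset.range N, g m * (1 / (1 - q)) := by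
              refine Finset.sum_le_sum fun m _ => ?_
              rw [← Finset.mul_sum]
              refine mul_le_mul_of_nonneg_left (le_trans ?_ ih) (hg0 m)
              exact Finset.sum_le_sum_of_subset_of_nonneg
                (Finset.range_subset_range.2 (by omega)) (fun i _ _ => hf0 i)
          _ = (∑ m ∈ Finset.range N, g m) * (1 / (1 - q)) := by rw [Finset.sum_mul]
          _ ≤ _ := by
              refine mul_le_mul_of_nonneg_right ?_ (by positivity)
              rw [← hgq]
              exact hgs.sum_le_tsum _ (fun i _ => hg0 i)
      have : q * (1 / (1 - q)) + 1 = 1 / (1 - q) := by field_simp; ring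
      linarith
  have hfsum : Summable f := summable_of_sum_range_le hf0 hbound
  have e1 : ∑' n, f n = 1 + q * ∑' n, f n := by
    conv_lhs => rw [hfsum.tsum_eq_zero_add]
    rw [hf1, ← hgq, tsum_mul_tsum_eq_tsum_sum_range_of_summable_norm hgs.norm hfsum.norm]
    simp only [hfs]
  have e2 : ∑' n, f n = 1 / (1 - q) := by
    rw [eq_div_iff h1q.ne']; linarith
  rw [← e2]
  exact hfsum.hasSum

/-! ### Ratios and convolutions in `𝒲(r)`. -/

theorem MemW.tendsto_ratio {r : ℝ} {γ : ℕ → ℝ} (h : MemW r γ) (j : ℕ) :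
    Tendsto (fun n => γ n / γ (n + j)) atTop (𝓝 (r⁻¹ ^ j)) := by
  induction j with
  | zero =>
    simp only [add_zero, pow_zero]
    exact tendsto_const_nhds.congr fun n => (div_self (h.pos n).ne').symm
  | succ j ih =>
    have h2 := (tendsto_add_atTop_iff_nat j).2 h.ratio
    rw [one_div] at h2
    rw [pow_succ]
    refine (ih.mul h2).congr fun n => ?_
    have := (h.pos (n + j)).ne'
    rw [add_assoc]
    field_simp

theorem MemW.tendsto_sub_ratio {r : ℝ} {γ : ℕ → ℝ} (h : MemW r γ) (j : ℕ) :
    Tendsto (fun n => γ (n - j) / γ n) atTop (𝓝 (r⁻¹ ^ j)) := by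
  rw [← tendsto_add_atTop_iff_nat j]
  simpa using h.tendsto_ratio j

theorem MemW.eventually_sum_le {r : ℝ} {γ : ℕ → ℝ} (h : MemW r γ) {ε : ℝ} (hε : 0 < ε) :
    ∀ᶠ m : ℕ in atTop, ∀ᶠ n : ℕ in atTop,
      ∑ i ∈ Finset.Icc m (n - m), γ (n - i) * γ i ≤ ε * γ n := by
  have h1 := h.conv.eventually_lt_const (show (0 : EReal) < (ε : EReal) by exact_mod_cast hε)
  filter_upwards [h1] with m hm
  filter_upwards [eventually_lt_of_limsup_lt hm] with n hn
  have hn' : (1 / γ n) * ∑ i ∈ Finset.Icc m (n - m), γ (n - i) * γ i < ε := by exact_mod_cast hn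
  have := h.pos n
  rw [one_div, inv_mul_lt_iff₀ this] at hn'
  linarith

/-- Three blocks of the convolution: `z` at an index near `n`, both indices at least `m`, and `b` at
an index near `n`. The outer blocks have finitely many terms with convergent ratios; the middle one
is negligible by the last condition of `𝒲(r)`. -/
theorem resolvent_decomp (c : ℝ) (b : ℕ → ℝ) {m n : ℕ} (hm : 1 ≤ m) (hn : 2 * m ≤ n) :
    resolvent c b n = ∑ j ∈ Finset.Ico 1 m, c * b j * resolvent c b (n - j) +
      ∑ j ∈ Finset.Icc m (n - m), c * b j * resolvent c b (n - j) +
      ∑ i ∈ Finset.range m, c * b (n - i) * resolvent c b i := by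
  have h0 : resolvent c b n = ∑ j ∈ Finset.Ico 1 (n + 1), c * b j * resolvent c b (n - j) := by
    obtain ⟨k, rfl⟩ : ∃ k, n = k + 1 := ⟨n - 1, by omega⟩
    rw [resolvent_succ, Finset.sum_Ico_eq_sum_range]
    refine Finset.sum_congr (by simp) fun i hi => ?_
    rw [add_comm 1 i, show k + 1 - (i + 1) = k - i by omega]
  have h3 : ∑ i ∈ Finset.range m, c * b (n - i) * resolvent c b i =
      ∑ j ∈ Finset.Ico (n - m + 1) (n + 1), c * b j * resolvent c b (n - j) := by
    rw [Finset.range_eq_Ico]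
    have := Finset.sum_Ico_reflect (fun j => c * b j * resolvent c b (n - j)) 0
      (show m ≤ n + 1 by omega)
    rw [show n + 1 - m = n - m + 1 by omega, Nat.sub_zero] at this
    rw [← this]
    refine Finset.sum_congr rfl fun i hi => ?_
    have := (Finset.mem_Ico.1 hi).2
    rw [show n - (n - i) = i by omega]
  have h2 : Finset.Icc m (n - m) = Finset.Ico m (n - m + 1) := by
    ext; simp only [Finset.mem_Icc, Finset.mem_Ico]; omega
  rw [h0, h3, h2, Finset.sum_Ico_consecutive _ hm (by omega),
    Finset.sum_Ico_consecutive _ (by omega) (by omega)]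

/-- A bounded sequence with `limsup |w| ≤ q * limsup |w|` and `q < 1` tends to zero. Phrasing it
through eventual bounds avoids handling the limsup itself. -/
theorem tendsto_zero_of_contraction {w : ℕ → ℝ} {q B₀ : ℝ} (hq0 : 0 ≤ q) (hq1 : q < 1)
    (hB₀ : ∀ n, |w n| ≤ B₀)
    (h : ∀ B, 0 ≤ B → (∀ᶠ n in atTop, |w n| ≤ B) →
      ∀ ε, 0 < ε → ∀ᶠ n in atTop, |w n| ≤ q * B + ε) :
    Tendsto w atTop (𝓝 0) := by
  have hB0 : 0 < B₀ + 1 := by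
    have := (abs_nonneg _).trans (hB₀ 0)
    linarith
  have key : ∀ k : ℕ, ∀ᶠ n in atTop, |w n| ≤ (B₀ + 1) * ((1 + q) / 2) ^ k := by
    intro k
    induction k with
    | zero => exact Eventually.of_forall fun n => by have := hB₀ n; simp; linarith
    | succ k ih =>
      have hp : 0 < (B₀ + 1) * ((1 + q) / 2) ^ k := by positivity
      -- With `ε = (1 - q) / 2 * B` the new bound is `(1 + q) / 2 * B`, so the bounds decay
      -- geometrically.
      filter_upwards [h _ hp.le ih _ (mul_pos (show 0 < (1 - q) / 2 by linarith) hp)] with n hn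
      refine hn.trans (le_of_eq ?_)
      rw [pow_succ]
      ring
  rw [tendsto_zero_iff_abs_tendsto_zero]
  rw [Metric.tendsto_atTop']
  intro ε hε
  have hlim : Tendsto (fun k : ℕ => (B₀ + 1) * ((1 + q) / 2) ^ k) atTop (𝓝 0) := by
    have := (tendsto_pow_atTop_nhds_zero_of_lt_one (r := (1 + q) / 2) (by linarith)
      (by linarith)).const_mul (B₀ + 1)
    simpa using this
  obtain ⟨k, hk⟩ := (hlim.eventually_lt_const hε).exists
  obtain ⟨N, hN⟩ := eventually_atTop.1 (key k)
  refine ⟨N, fun n hn => ?_⟩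
  have := hN n (by omega)
  simp only [Function.comp, dist_zero_right, Real.norm_eq_abs, abs_abs]
  linarith

/-! ### The renewal theorem and stability of `𝒲(r)`. -/

section

variable {c r : ℝ} {b : ℕ → ℝ}

theorem MemW.sum_Ico_tendsto (hb : MemW r b) (c : ℝ) (m : ℕ) :
    Tendsto (fun n => ∑ j ∈ Finset.Ico 1 m, c * b j * (b (n - j) / b n)) atTop
      (𝓝 (∑ j ∈ Finset.Ico 1 m, c * b j * r⁻¹ ^ j)) :=
  tendsto_finsetSum _ fun j _ => (hb.tendsto_sub_ratio j).const_mul _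

theorem MemW.sum_range_tendsto (hb : MemW r b) (f : ℕ → ℝ) (m : ℕ) :
    Tendsto (fun n => ∑ i ∈ Finset.range m, f i * (b (n - i) / b n)) atTop
      (𝓝 (∑ i ∈ Finset.range m, f i * r⁻¹ ^ i)) :=
  tendsto_finsetSum _ fun j _ => (hb.tendsto_sub_ratio j).const_mul _

theorem sum_Ico_eq (c x : ℝ) (b : ℕ → ℝ) (m : ℕ) :
    ∑ j ∈ Finset.Ico 1 m, c * b j * x ^ j =
      c * ∑ j ∈ Finset.range (m - 1), b (j + 1) * x ^ (j + 1) := by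
  rw [Finset.sum_Ico_eq_sum_range, Finset.mul_sum]
  refine Finset.sum_congr rfl fun j _ => ?_
  rw [add_comm 1 j]
  ring

theorem sum_Ico_le (hc : 0 < c) (hr0 : 0 < r) (hb : ∀ j, 0 < b j)
    (hs : Summable fun j : ℕ => b (j + 1) * r⁻¹ ^ (j + 1)) (m : ℕ) :
    ∑ j ∈ Finset.Ico 1 m, c * b j * r⁻¹ ^ j ≤ c * ∑' j : ℕ, b (j + 1) * r⁻¹ ^ (j + 1) := by
  rw [sum_Ico_eq]
  refine mul_le_mul_of_nonneg_left (hs.sum_le_tsum _ fun j _ => ?_) hc.le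
  have := hb (j + 1)
  positivity

theorem tendsto_sum_Ico (c : ℝ)
    (hs : Summable fun j : ℕ => b (j + 1) * r⁻¹ ^ (j + 1)) :
    Tendsto (fun m => ∑ j ∈ Finset.Ico 1 m, c * b j * r⁻¹ ^ j) atTop
      (𝓝 (c * ∑' j : ℕ, b (j + 1) * r⁻¹ ^ (j + 1))) := by
  simp only [sum_Ico_eq]
  exact (hs.hasSum.tendsto_sum_nat.comp (tendsto_sub_atTop_nat 1)).const_mul c

/-- A sequence in `𝒲(r)` dominates its resolvent. -/
theorem exists_resolvent_le (hc : 0 < c) (hr0 : 0 < r) (hb : MemW r b)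
    (hs : Summable fun j : ℕ => b (j + 1) * r⁻¹ ^ (j + 1))
    (hlt : c * ∑' j : ℕ, b (j + 1) * r⁻¹ ^ (j + 1) < 1) :
    ∃ K, 0 < K ∧ ∀ n, resolvent c b n ≤ K * b n := by
  set q := c * ∑' j : ℕ, b (j + 1) * r⁻¹ ^ (j + 1) with hq
  set z := resolvent c b with hz
  have hz0 : ∀ n, 0 < z n := resolvent_pos hc hb.pos
  -- Relative to `K * b n`, the three blocks will cost `q + δ`, `δ` and `(1 - q) / 2`, which add up
  -- to exactly `1`.
  set δ := (1 - q) / 4 with hδ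
  have hδ0 : 0 < δ := by rw [hδ]; linarith
  obtain ⟨m, hm, hm1⟩ := ((hb.eventually_sum_le (div_pos hδ0 hc)).and
    (eventually_ge_atTop 1)).exists
  set K₀ := ∑ i ∈ Finset.range m, (c * z i) * r⁻¹ ^ i + 1 with hK₀
  have e1 : ∀ᶠ n in atTop, ∑ j ∈ Finset.Ico 1 m, c * b j * (b (n - j) / b n) ≤ q + δ := by
    refine (hb.sum_Ico_tendsto c m).eventually_le_const ?_
    have := sum_Ico_le hc hr0 hb.pos hs m
    linarith
  have e2 : ∀ᶠ n in atTop, ∑ i ∈ Finset.range m, (c * z i) * (b (n - i) / b n) ≤ K₀ :=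
    (hb.sum_range_tendsto (fun i => c * z i) m).eventually_le_const (by linarith)
  obtain ⟨N, hN⟩ := eventually_atTop.1
    (((e1.and e2).and hm).and (eventually_ge_atTop (2 * m)))
  have hK₀0 : 0 < K₀ := by
    have : 0 ≤ ∑ i ∈ Finset.range m, (c * z i) * r⁻¹ ^ i :=
      Finset.sum_nonneg fun i _ => by have := hz0 i; positivity
    linarith
  have hd0 : ∀ k, 0 ≤ z k / b k := fun k => (div_pos (hz0 k) (hb.pos k)).le
  -- The first summand makes `K₀ ≤ K * (1 - q) / 2`, which closes the induction for `n ≥ N`; the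
  -- finite sum covers `n < N`.
  set K := 2 * K₀ / (1 - q) + ∑ k ∈ Finset.range N, z k / b k with hK
  have h1q : 0 < 1 - q := by linarith
  have hS0 : 0 ≤ ∑ k ∈ Finset.range N, z k / b k := Finset.sum_nonneg fun k _ => hd0 k
  have hKpos : 0 < K := by positivity
  refine ⟨K, hKpos, fun n => ?_⟩
  induction n using Nat.strong_induction_on with
  | _ n ih =>
    have hbn := hb.pos n
    rcases lt_or_ge n N with hn | hn
    · rw [← div_le_iff₀ hbn]
      have : z n / b n ≤ _ := Finset.single_le_sum (f := fun k => z k / b k) (fun k _ => hd0 k)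
        (Finset.mem_range.2 hn)
      have h2 : 0 < 2 * K₀ / (1 - q) := by positivity
      linarith
    · obtain ⟨⟨⟨h1, h2⟩, h3⟩, h4⟩ := hN n hn
      rw [hz, resolvent_decomp c b hm1 h4, ← hz]
      have t1 : ∑ j ∈ Finset.Ico 1 m, c * b j * z (n - j) ≤ K * ((q + δ) * b n) := by
        calc _ ≤ ∑ j ∈ Finset.Ico 1 m, K * (c * b j * (b (n - j) / b n)) * b n := by
              refine Finset.sum_le_sum fun j hj => ?_
              have hj1 := (Finset.mem_Ico.1 hj).1
              have := ih (n - j) (by omega)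
              have hbj := hb.pos j
              calc c * b j * z (n - j) ≤ c * b j * (K * b (n - j)) := by gcongr
                _ = _ := by field_simp
          _ = K * ((∑ j ∈ Finset.Ico 1 m, c * b j * (b (n - j) / b n)) * b n) := by
              rw [← Finset.sum_mul, ← Finset.mul_sum, mul_assoc]
          _ ≤ _ := by gcongr
      have t2 : ∑ j ∈ Finset.Icc m (n - m), c * b j * z (n - j) ≤ K * (δ * b n) := by
        calc _ ≤ ∑ j ∈ Finset.Icc m (n - m), K * c * (b (n - j) * b j) := by
              refine Finset.sum_le_sum fun j hj => ?_
              have hj1 := (Finset.mem_Icc.1 hj).1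
              have := ih (n - j) (by omega)
              have hbj := hb.pos j
              calc c * b j * z (n - j) ≤ c * b j * (K * b (n - j)) := by gcongr
                _ = _ := by ring
          _ = K * c * ∑ j ∈ Finset.Icc m (n - m), (b (n - j) * b j) := by rw [Finset.mul_sum]
          _ ≤ K * c * (δ / c * b n) := by gcongr
          _ = _ := by field_simp
      have t3 : ∑ i ∈ Finset.range m, c * b (n - i) * z i ≤ K₀ * b n := by
        calc _ = (∑ i ∈ Finset.range m, (c * z i) * (b (n - i) / b n)) * b n := by
              rw [Finset.sum_mul]
              refine Finset.sum_congr rfl fun i _ => ?_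
              field_simp
          _ ≤ _ := by gcongr
      have t4 : K₀ ≤ K * ((1 - q) / 2) := by
        have : 2 * K₀ / (1 - q) ≤ K := by linarith
        calc K₀ = 2 * K₀ / (1 - q) * ((1 - q) / 2) := by field_simp
          _ ≤ _ := by gcongr
      have t5 : K₀ * b n ≤ K * ((1 - q) / 2) * b n := by gcongr
      have t6 : K * ((q + δ) * b n) + K * (δ * b n) + K * ((1 - q) / 2) * b n = K * b n := by
        rw [hδ]; ring
      linarith

/-- The renewal theorem for the class `𝒲(r)`. -/
theorem tendsto_resolvent_div (hc : 0 < c) (hr0 : 0 < r) (hb : MemW r b)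
    (hs : Summable fun j : ℕ => b (j + 1) * r⁻¹ ^ (j + 1))
    (hlt : c * ∑' j : ℕ, b (j + 1) * r⁻¹ ^ (j + 1) < 1) :
    Tendsto (fun n => resolvent c b n / b n) atTop
      (𝓝 (c / (1 - c * ∑' j : ℕ, b (j + 1) * r⁻¹ ^ (j + 1)) ^ 2)) := by
  obtain ⟨K, hK, hzK⟩ := exists_resolvent_le hc hr0 hb hs hlt
  have hY := hasSum_resolvent hc.le (fun j _ => (hb.pos j).le) (inv_pos.2 hr0).le hs hlt
  have hqm := tendsto_sum_Ico c hs
  have hqle := sum_Ico_le hc hr0 hb.pos hs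
  have hqnn : 0 ≤ c * ∑' j : ℕ, b (j + 1) * r⁻¹ ^ (j + 1) :=
    mul_nonneg hc.le (tsum_nonneg fun j => by have := hb.pos (j + 1); positivity)
  set q := c * ∑' j : ℕ, b (j + 1) * r⁻¹ ^ (j + 1) with hq
  set z := resolvent c b with hz
  have hz0 : ∀ n, 0 < z n := resolvent_pos hc hb.pos
  -- The solution of `ℓ = q * ℓ + c / (1 - q)`: the block near `n` returns `q * ℓ`, the block with
  -- `b` near `n` returns `c * ∑ z i * r⁻¹ ^ i = c / (1 - q)`.
  set ℓ := c / (1 - q) ^ 2 with hℓ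
  have h1q : 0 < 1 - q := by linarith
  have hℓ0 : 0 < ℓ := by positivity
  suffices h : Tendsto (fun n => z n / b n - ℓ) atTop (𝓝 0) by
    simpa using h.add_const ℓ
  refine tendsto_zero_of_contraction (q := q) (B₀ := K + ℓ) hqnn hlt ?_ ?_
  · intro n
    have h1 : z n / b n ≤ K := (div_le_iff₀ (hb.pos n)).2 (hzK n)
    have h2 : 0 < z n / b n := div_pos (hz0 n) (hb.pos n)
    rw [abs_le]
    constructor <;> linarith
  · intro B hB hwB ε hε
    have hT : Tendsto (fun m => ∑ i ∈ Finset.range m, (c * z i) * r⁻¹ ^ i) atTop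
        (𝓝 (c * (1 / (1 - q)))) := by
      refine (hY.tendsto_sum_nat.const_mul c).congr fun m => ?_
      rw [Finset.mul_sum]
      exact Finset.sum_congr rfl fun i _ => by ring
    have hlim : Tendsto (fun m => |(∑ j ∈ Finset.Ico 1 m, c * b j * r⁻¹ ^ j) * ℓ +
        ∑ i ∈ Finset.range m, (c * z i) * r⁻¹ ^ i - ℓ|) atTop (𝓝 0) := by
      have h0 : |q * ℓ + c * (1 / (1 - q)) - ℓ| = 0 := by
        rw [abs_eq_zero, hℓ]
        field_simp
        ring
      rw [← h0]
      exact (((hqm.mul_const ℓ).add hT).sub_const ℓ).abs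
    obtain ⟨m, ⟨hm, hm1⟩, hmε⟩ := (((hb.eventually_sum_le (ε := ε / 4 / (c * K)) (by positivity)).and
      (eventually_ge_atTop 1)).and (hlim.eventually_lt_const (show 0 < ε / 4 by linarith))).exists
    have hA := hb.sum_Ico_tendsto c m
    have hT' := hb.sum_range_tendsto (fun i => c * z i) m
    have e1 := (((hA.mul_const ℓ).add hT').sub_const ℓ).abs.eventually_lt_const hmε
    have e2 : ∀ᶠ n in atTop, B * ∑ j ∈ Finset.Ico 1 m, c * b j * (b (n - j) / b n) <
        B * q + ε / 4 := by
      refine (hA.const_mul B).eventually_lt_const ?_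
      have := mul_le_mul_of_nonneg_left (hqle m) hB
      linarith
    have e3 : ∀ᶠ n in atTop, ∀ j ∈ Finset.Ico 1 m, |z (n - j) / b (n - j) - ℓ| ≤ B := by
      rw [Finset.eventually_all]
      intro j _
      exact (tendsto_sub_atTop_nat j).eventually hwB
    filter_upwards [e1, e2, e3, hm, eventually_ge_atTop (2 * m)] with n h1 h2 h3 h4 h5
    have hbn := hb.pos n
    -- Subtracting `ℓ` inside the first block isolates the contracting part; the bracket is small by
    -- the equation for `ℓ`, and the last term is the middle block.
    have hdec : z n / b n - ℓ =
        ∑ j ∈ Finset.Ico 1 m, c * b j * (b (n - j) / b n) * (z (n - j) / b (n - j) - ℓ) +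
        ((∑ j ∈ Finset.Ico 1 m, c * b j * (b (n - j) / b n)) * ℓ +
          ∑ i ∈ Finset.range m, (c * z i) * (b (n - i) / b n) - ℓ) +
        (∑ j ∈ Finset.Icc m (n - m), c * b j * z (n - j)) / b n := by
      rw [hz, resolvent_decomp c b hm1 h5, ← hz, add_div, add_div, Finset.sum_mul]
      have s1 : (∑ j ∈ Finset.Ico 1 m, c * b j * z (n - j)) / b n =
          ∑ j ∈ Finset.Ico 1 m, c * b j * (b (n - j) / b n) * (z (n - j) / b (n - j) - ℓ) +
          ∑ j ∈ Finset.Ico 1 m, c * b j * (b (n - j) / b n) * ℓ := by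
        rw [← Finset.sum_add_distrib, Finset.sum_div]
        refine Finset.sum_congr rfl fun j _ => ?_
        have := (hb.pos (n - j)).ne'
        field_simp
        ring
      have s2 : (∑ i ∈ Finset.range m, c * b (n - i) * z i) / b n =
          ∑ i ∈ Finset.range m, (c * z i) * (b (n - i) / b n) := by
        rw [Finset.sum_div]
        refine Finset.sum_congr rfl fun j _ => ?_
        field_simp
      rw [s1, s2]
      ring
    have a1 : |∑ j ∈ Finset.Ico 1 m, c * b j * (b (n - j) / b n) *
        (z (n - j) / b (n - j) - ℓ)| ≤ B * q + ε / 4 := by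
      refine (Finset.abs_sum_le_sum_abs _ _).trans (le_trans ?_ h2.le)
      rw [Finset.mul_sum]
      refine Finset.sum_le_sum fun j hj => ?_
      have hp : 0 ≤ c * b j * (b (n - j) / b n) := by
        have := hb.pos j
        have := hb.pos (n - j)
        positivity
      rw [abs_mul, abs_of_nonneg hp, mul_comm]
      exact mul_le_mul_of_nonneg_right (h3 j hj) hp
    have a2 : |(∑ j ∈ Finset.Icc m (n - m), c * b j * z (n - j)) / b n| ≤ ε / 4 := by
      rw [abs_of_nonneg (div_nonneg (Finset.sum_nonneg fun j _ => by
        have := hb.pos j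
        have := hz0 (n - j)
        positivity) hbn.le), div_le_iff₀ hbn]
      calc _ ≤ ∑ j ∈ Finset.Icc m (n - m), c * K * (b (n - j) * b j) := by
            refine Finset.sum_le_sum fun j hj => ?_
            have hbj := hb.pos j
            calc c * b j * z (n - j) ≤ c * b j * (K * b (n - j)) := by gcongr; exact hzK _
              _ = _ := by ring
        _ = c * K * ∑ j ∈ Finset.Icc m (n - m), b (n - j) * b j := by rw [Finset.mul_sum]
        _ ≤ c * K * (ε / 4 / (c * K) * b n) := by gcongr
        _ = _ := by field_simp
    rw [hdec]
    refine (abs_add_three _ _ _).trans ?_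
    rw [mul_comm q B]
    linarith

/-- Here `r < 1` enters: the ratios `b n / b (n + 1)` tend to `1 / r > 1`, so `b` is eventually
decreasing. -/
theorem MemW.eventually_add_le (hb : MemW r b) (hr0 : 0 < r) (hr1 : r < 1) :
    ∀ᶠ n in atTop, ∀ j, b (n + j) ≤ b n := by
  have h1 : (1 : ℝ) < 1 / r := by rw [lt_div_iff₀ hr0]; linarith
  obtain ⟨N, hN⟩ := eventually_atTop.1 (hb.ratio.eventually_const_lt h1)
  refine eventually_atTop.2 ⟨N, fun n hn j => ?_⟩
  induction j with
  | zero => simp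
  | succ j ih =>
    have := hN (n + j) (by omega)
    rw [lt_div_iff₀ (hb.pos _), one_mul] at this
    exact this.le.trans ih

theorem MemW.tendsto_add_ratio (hb : MemW r b) (hr0 : 0 < r) (j : ℕ) :
    Tendsto (fun n => b (n + j) / b n) atTop (𝓝 (r ^ j)) := by
  have := (hb.tendsto_ratio j).inv₀ (by positivity)
  simpa using this

theorem summable_of_le_pow {x y : ℝ} (hb : ∀ j, 1 ≤ j → 0 ≤ b j) (hx : 0 ≤ x) (hxy : x ≤ y)
    (hs : Summable fun j : ℕ => b (j + 1) * y ^ (j + 1)) :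
    Summable fun j : ℕ => b (j + 1) * x ^ (j + 1) :=
  Summable.of_nonneg_of_le (fun j => mul_nonneg (hb _ (by omega)) (by positivity))
    (fun j => mul_le_mul_of_nonneg_left (by gcongr) (hb _ (by omega))) hs

theorem mul_tsum_lt_one {x y : ℝ} (hc : 0 ≤ c) (hb : ∀ j, 1 ≤ j → 0 ≤ b j) (hx : 0 ≤ x)
    (hxy : x ≤ y) (hs : Summable fun j : ℕ => b (j + 1) * y ^ (j + 1))
    (hlt : c * ∑' j : ℕ, b (j + 1) * y ^ (j + 1) < 1) :
    c * ∑' j : ℕ, b (j + 1) * x ^ (j + 1) < 1 :=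
  (mul_le_mul_of_nonneg_left ((summable_of_le_pow hb hx hxy hs).tsum_le_tsum
    (fun j => mul_le_mul_of_nonneg_left (by gcongr) (hb _ (by omega))) hs) hc).trans_lt hlt

theorem summable_resolvent (hc : 0 ≤ c) (hr0 : 0 < r) (hr1 : r < 1) (hb : ∀ j, 1 ≤ j → 0 ≤ b j)
    (hs : Summable fun j : ℕ => b (j + 1) * r⁻¹ ^ (j + 1))
    (hlt : c * ∑' j : ℕ, b (j + 1) * r⁻¹ ^ (j + 1) < 1) :
    Summable (resolvent c b) := by
  have hxy : (1 : ℝ) ≤ r⁻¹ := (one_le_inv₀ hr0).2 hr1.le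
  have := hasSum_resolvent hc hb zero_le_one (summable_of_le_pow hb zero_le_one hxy hs)
    (mul_tsum_lt_one hc hb zero_le_one hxy hs hlt)
  simpa using this.summable

/-- Termwise, `z (j + n) / b n` is `b (n + j) / b n`, with limit `r ^ j`, times `z (n + j) / b (n +
j)`, with the renewal limit. The bound `z ≤ K * b` and eventual monotonicity of `b` dominate the
terms by `K * z j`. -/
theorem tendsto_tsum_resolvent_div (hc : 0 < c) (hr0 : 0 < r) (hr1 : r < 1) (hb : MemW r b)
    (hs : Summable fun j : ℕ => b (j + 1) * r⁻¹ ^ (j + 1))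
    (hlt : c * ∑' j : ℕ, b (j + 1) * r⁻¹ ^ (j + 1) < 1) :
    Tendsto (fun n => (∑' j, resolvent c b j * resolvent c b (j + n)) / b n) atTop
      (𝓝 (1 / (1 - c * ∑' j : ℕ, b (j + 1) * r ^ (j + 1)) *
        (c / (1 - c * ∑' j : ℕ, b (j + 1) * r⁻¹ ^ (j + 1)) ^ 2))) := by
  have hb' : ∀ j, 1 ≤ j → 0 ≤ b j := fun j _ => (hb.pos j).le
  obtain ⟨K, hK, hzK⟩ := exists_resolvent_le hc hr0 hb hs hlt
  have hxy : r ≤ r⁻¹ := hr1.le.trans ((one_le_inv₀ hr0).2 hr1.le)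
  have hsr := hasSum_resolvent hc.le hb' hr0.le (summable_of_le_pow hb' hr0.le hxy hs)
    (mul_tsum_lt_one hc.le hb' hr0.le hxy hs hlt)
  have hlim := tendsto_resolvent_div hc hr0 hb hs hlt
  have hzs := summable_resolvent hc.le hr0 hr1 hb' hs hlt
  have hz0 : ∀ n, 0 < resolvent c b n := resolvent_pos hc hb.pos
  rw [← hsr.tsum_eq, ← tsum_mul_right]
  simp only [← tsum_div_const]
  refine tendsto_tsum_of_dominated_convergence (bound := fun j => resolvent c b j * K)
    (hzs.mul_right K) (fun j => ?_) ?_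
  · have h1 := hlim.comp (tendsto_add_atTop_nat j)
    refine (((hb.tendsto_add_ratio hr0 j).mul h1).const_mul (resolvent c b j)).congr' ?_ |>.trans_eq ?_
    · refine Eventually.of_forall fun n => ?_
      have := (hb.pos (n + j)).ne'
      have := (hb.pos n).ne'
      simp only [Function.comp]
      rw [add_comm j n]
      field_simp
    · rw [mul_assoc]
  · filter_upwards [hb.eventually_add_le hr0 hr1] with n hn j
    have hbn := hb.pos n
    rw [Real.norm_of_nonneg (by have := hz0 j; have := hz0 (j + n); positivity), mul_div_assoc]
    refine mul_le_mul_of_nonneg_left ?_ (hz0 j).le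
    rw [div_le_iff₀ hbn]
    refine (hzK _).trans (mul_le_mul_of_nonneg_left ?_ hK.le)
    rw [add_comm]
    exact hn j

/-- The class `𝒲(r)` is closed under asymptotic proportionality. -/
theorem MemW.of_tendsto_div {γ : ℕ → ℝ} {l : ℝ} (hb : MemW r b) (hr0 : 0 < r) (hl : 0 < l)
    (hγ : ∀ n, 0 < γ n) (h : Tendsto (fun n => γ n / b n) atTop (𝓝 l)) : MemW r γ := by
  obtain ⟨C, hC⟩ := h.bddAbove_range
  have hinv : Tendsto (fun n => b n / γ n) atTop (𝓝 l⁻¹) := by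
    simpa using h.inv₀ hl.ne'
  obtain ⟨D, hD⟩ := hinv.bddAbove_range
  have hγC : ∀ n, γ n ≤ C * b n := fun n =>
    (div_le_iff₀ (hb.pos n)).1 (hC (Set.mem_range_self n))
  have hbD : ∀ n, b n ≤ D * γ n := fun n =>
    (div_le_iff₀ (hγ n)).1 (hD (Set.mem_range_self n))
  have hC0 : 0 < C := (div_pos (hγ 0) (hb.pos 0)).trans_le (hC (Set.mem_range_self 0))
  have hD0 : 0 < D := (div_pos (hb.pos 0) (hγ 0)).trans_le (hD (Set.mem_range_self 0))
  refine ⟨hγ, ?_, ?_, ?_⟩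
  · have h1 : Tendsto (fun n => γ n / b n * (b n / b (n + 1)) * (b (n + 1) / γ (n + 1))) atTop
        (𝓝 (l * (1 / r) * l⁻¹)) :=
      (h.mul hb.ratio).mul (hinv.comp (tendsto_add_atTop_nat 1))
    rw [mul_right_comm, mul_inv_cancel₀ hl.ne', one_mul] at h1
    refine h1.congr fun n => ?_
    have := (hb.pos (n + 1)).ne'
    have := (hb.pos n).ne'
    field_simp
  · refine Summable.of_nonneg_of_le (fun n => ?_) (fun n => ?_) (hb.summable.mul_left C)
    · have := hγ n
      positivity
    · rw [← mul_assoc]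
      exact mul_le_mul_of_nonneg_right (hγC n) (by positivity)
  · have hnn : ∀ m n, (0 : EReal) ≤
        (((1 / γ n) * ∑ i ∈ Finset.Icc m (n - m), γ (n - i) * γ i : ℝ) : EReal) := by
      intro m n
      refine EReal.coe_nonneg.2 (mul_nonneg (one_div_pos.2 (hγ n)).le
        (Finset.sum_nonneg fun i _ => (mul_pos (hγ _) (hγ _)).le))
    rw [tendsto_order]
    refine ⟨fun x hx => Eventually.of_forall fun m => hx.trans_le ?_, fun x hx => ?_⟩
    · exact le_limsup_of_frequently_le (Frequently.of_forall fun n => hnn m n)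
    · obtain ⟨ε, hε0, hεx⟩ := EReal.lt_iff_exists_real_btwn.1 hx
      have hε : 0 < ε := by exact_mod_cast hε0
      -- `C` is spent twice, on the two factors `γ ≤ C * b`, and `D` once, on `b n ≤ D * γ n`.
      filter_upwards [hb.eventually_sum_le (ε := ε / (C * C * D)) (by positivity)] with m hm
      refine lt_of_le_of_lt (limsup_le_of_le (h := ?_)) hεx
      filter_upwards [hm] with n hn
      refine EReal.coe_le_coe_iff.2 ?_
      rw [one_div, inv_mul_le_iff₀ (hγ n)]
      calc ∑ i ∈ Finset.Icc m (n - m), γ (n - i) * γ i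
          ≤ ∑ i ∈ Finset.Icc m (n - m), C * C * (b (n - i) * b i) := by
            refine Finset.sum_le_sum fun i _ => ?_
            have := hγ i
            have := hb.pos (n - i)
            calc γ (n - i) * γ i ≤ (C * b (n - i)) * (C * b i) := by
                  gcongr <;> exact hγC _
              _ = _ := by ring
        _ = C * C * ∑ i ∈ Finset.Icc m (n - m), b (n - i) * b i := by rw [Finset.mul_sum]
        _ ≤ C * C * (ε / (C * C * D) * (D * γ n)) := by
            gcongr
            refine hn.trans ?_
            gcongr
            exact hbD n
        _ = γ n * ε := by field_simp

end

/-! ### The past of the shocks. -/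

section

variable {Ω : Type*} {ξ : ℤ → Ω → ℝ}

/-- The σ-algebra generated by the shocks strictly before time `k`. -/
abbrev past (ξ : ℤ → Ω → ℝ) (k : ℤ) : MeasurableSpace Ω :=
  ⨆ i ∈ Set.Iio k, MeasurableSpace.comap (ξ i) inferInstance

theorem past_mono {k l : ℤ} (h : k ≤ l) : past ξ k ≤ past ξ l :=
  biSup_mono fun _ hi => lt_of_lt_of_le hi h

theorem measurable_past {i k : ℤ} (h : i < k) : Measurable[past ξ k] (ξ i) :=
  measurable_iff_comap_le.2
    (le_biSup (fun i => MeasurableSpace.comap (ξ i) inferInstance) (Set.mem_Iio.2 h))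

end

/-! ### Limits of integrals, orthogonal expansions, independence from the past. -/

section

variable {Ω : Type*} [MeasurableSpace Ω] {P : Measure Ω} {ξ : ℤ → Ω → ℝ}

theorem ae_summable_of_integral_norm_le {f : ℕ → Ω → ℝ} {C : ℕ → ℝ}
    (hf : ∀ j, Integrable (f j) P) (hC : ∀ j, ∫ ω, ‖f j ω‖ ∂P ≤ C j) (hs : Summable C) :
    ∀ᵐ ω ∂P, Summable fun j => f j ω := by
  have h1 : ∫⁻ ω, ∑' j, ‖f j ω‖ₑ ∂P ≠ ⊤ := by
    rw [lintegral_tsum fun j => (hf j).aestronglyMeasurable.enorm]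
    have h2 : ∀ j, ∫⁻ ω, ‖f j ω‖ₑ ∂P ≤ ENNReal.ofReal (C j) := fun j => by
      rw [← ofReal_integral_norm_eq_lintegral_enorm (hf j)]
      exact ENNReal.ofReal_le_ofReal (hC j)
    exact ne_top_of_le_ne_top hs.tsum_ofReal_ne_top (ENNReal.tsum_le_tsum h2)
  have hm : AEMeasurable (fun ω => ∑' j, ‖f j ω‖ₑ) P :=
    AEMeasurable.tsum fun j => (hf j).aestronglyMeasurable.enorm
  filter_upwards [ae_lt_top' hm h1] with ω hω
  have := ENNReal.summable_toReal hω.ne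
  refine Summable.of_norm (this.congr fun j => ?_)
  simp

theorem ae_bddAbove_of_integral_le {f : ℕ → Ω → ℝ} {C : ℝ}
    (hf : ∀ n, Integrable (f n) P) (h0 : ∀ᵐ ω ∂P, ∀ n, 0 ≤ f n ω)
    (hmono : ∀ᵐ ω ∂P, Monotone fun n => f n ω) (hC : ∀ n, ∫ ω, f n ω ∂P ≤ C) :
    ∀ᵐ ω ∂P, BddAbove (Set.range fun n => f n ω) := by
  have hm : ∀ n, AEMeasurable (fun ω => ENNReal.ofReal (f n ω)) P :=
    fun n => (hf n).aemeasurable.ennreal_ofReal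
  have h1 : ∫⁻ ω, ⨆ n, ENNReal.ofReal (f n ω) ∂P ≠ ⊤ := by
    rw [lintegral_iSup' hm (hmono.mono fun ω h i j hij => ENNReal.ofReal_le_ofReal (h hij))]
    refine ne_top_of_le_ne_top (b := ENNReal.ofReal C) ENNReal.ofReal_ne_top (iSup_le fun n => ?_)
    rw [← ofReal_integral_eq_lintegral_ofReal (hf n) (h0.mono fun ω h => h n)]
    exact ENNReal.ofReal_le_ofReal (hC n)
  filter_upwards [ae_lt_top' (AEMeasurable.iSup hm) h1, h0] with ω hω h0ω
  refine ⟨(⨆ n, ENNReal.ofReal (f n ω)).toReal, ?_⟩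
  rintro _ ⟨n, rfl⟩
  rw [← ENNReal.ofReal_le_iff_le_toReal hω.ne]
  exact le_iSup (fun n => ENNReal.ofReal (f n ω)) n

/-- Monotone convergence in a form that also yields integrability of the limit. It transfers all
moments from finite-past processes to the stationary one. -/
theorem integrable_and_integral_eq_of_monotone {f : ℕ → Ω → ℝ} {F : Ω → ℝ} {l : ℝ}
    (hf : ∀ n, Integrable (f n) P) (h0 : ∀ᵐ ω ∂P, ∀ n, 0 ≤ f n ω)
    (hmono : ∀ᵐ ω ∂P, Monotone fun n => f n ω)
    (hF : ∀ᵐ ω ∂P, Tendsto (fun n => f n ω) atTop (𝓝 (F ω)))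
    (hl : Tendsto (fun n => ∫ ω, f n ω ∂P) atTop (𝓝 l)) :
    Integrable F P ∧ ∫ ω, F ω ∂P = l := by
  have hFm : AEStronglyMeasurable F P :=
    aestronglyMeasurable_of_tendsto_ae atTop (fun n => (hf n).aestronglyMeasurable) hF
  have hF0 : 0 ≤ᵐ[P] F := by
    filter_upwards [hF, h0] with ω h1 h2
    exact ge_of_tendsto' h1 h2
  have hl0 : 0 ≤ l := ge_of_tendsto' hl fun n => integral_nonneg_of_ae (h0.mono fun ω h => h n)
  have h1 : Tendsto (fun n => ∫⁻ ω, ENNReal.ofReal (f n ω) ∂P) atTop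
      (𝓝 (∫⁻ ω, ENNReal.ofReal (F ω) ∂P)) :=
    lintegral_tendsto_of_tendsto_of_monotone (fun n => (hf n).aemeasurable.ennreal_ofReal)
      (hmono.mono fun ω h i j hij => ENNReal.ofReal_le_ofReal (h hij))
      (hF.mono fun ω h => (ENNReal.continuous_ofReal.tendsto _).comp h)
  have h2 : Tendsto (fun n => ∫⁻ ω, ENNReal.ofReal (f n ω) ∂P) atTop (𝓝 (ENNReal.ofReal l)) := by
    refine ((ENNReal.continuous_ofReal.tendsto _).comp hl).congr fun n => ?_
    exact ofReal_integral_eq_lintegral_ofReal (hf n) (h0.mono fun ω h => h n)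
  have h3 := tendsto_nhds_unique h1 h2
  have hi : Integrable F P := by
    refine ⟨hFm, ?_⟩
    rw [hasFiniteIntegral_iff_ofReal hF0, h3]
    exact ENNReal.ofReal_lt_top
  refine ⟨hi, ?_⟩
  rw [integral_eq_lintegral_of_nonneg_ae hF0 hFm, h3, ENNReal.toReal_ofReal hl0]

/-- Hölder would only give an integrable product; independence of the squares gives a
square-integrable one. -/
theorem memLp_two_mul_of_indepFun {X Y : Ω → ℝ} (h : IndepFun X Y P)
    (hX : MemLp X 2 P) (hY : MemLp Y 2 P) : MemLp (fun ω => X ω * Y ω) 2 P := by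
  refine (memLp_two_iff_integrable_sq (hX.1.mul hY.1)).2 ?_
  have h2 : IndepFun (fun ω => X ω ^ 2) (fun ω => Y ω ^ 2) P :=
    h.comp (φ := fun x : ℝ => x ^ 2) (ψ := fun x : ℝ => x ^ 2) (by fun_prop) (by fun_prop)
  refine (h2.integrable_mul hX.integrable_sq hY.integrable_sq).congr ?_
  exact Eventually.of_forall fun ω => by simp [mul_pow]

theorem integral_add_sum [IsProbabilityMeasure P] {e : ℕ → Ω → ℝ} (he : ∀ i, MemLp (e i) 2 P)
    (h0 : ∀ i, ∫ ω, e i ω ∂P = 0) (α : ℝ) (u : ℕ → ℝ) (S : Finset ℕ) :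
    ∫ ω, (α + ∑ i ∈ S, u i * e i ω) ∂P = α := by
  have hi : ∀ i, Integrable (e i) P := fun i => (he i).integrable one_le_two
  rw [integral_add (integrable_const _) (integrable_finsetSum _ fun i _ => (hi i).const_mul _),
    integral_finsetSum _ fun i _ => (hi i).const_mul _]
  simp [integral_const_mul, h0]

/-- Centring removes the linear terms and orthogonality leaves the diagonal. The nesting `S ⊆ T` is
that of the time windows up to `n` and up to `n + p`. -/
theorem integral_mul_add_sum [IsProbabilityMeasure P] {e : ℕ → Ω → ℝ} {d : ℕ → ℝ}
    (he : ∀ i, MemLp (e i) 2 P) (h0 : ∀ i, ∫ ω, e i ω ∂P = 0)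
    (h2 : ∀ i j, ∫ ω, e i ω * e j ω ∂P = if i = j then d i else 0)
    (α β : ℝ) (u w : ℕ → ℝ) {S T : Finset ℕ} (hST : S ⊆ T) :
    ∫ ω, (α + ∑ i ∈ S, u i * e i ω) * (β + ∑ i ∈ T, w i * e i ω) ∂P =
      α * β + ∑ i ∈ S, u i * w i * d i := by
  have hi : ∀ i, Integrable (e i) P := fun i => (he i).integrable one_le_two
  have hij : ∀ i j, Integrable (fun ω => e i ω * e j ω) P := fun i j => (he i).integrable_mul (he j)
  have e1 : ∀ ω, (α + ∑ i ∈ S, u i * e i ω) * (β + ∑ i ∈ T, w i * e i ω) =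
      (α * β + ∑ i ∈ S, (β * u i) * e i ω) + (∑ i ∈ T, (α * w i) * e i ω +
        ∑ i ∈ S, ∑ j ∈ T, (u i * w j) * (e i ω * e j ω)) := by
    intro ω
    have a1 : ∑ i ∈ S, (β * u i) * e i ω = β * ∑ i ∈ S, u i * e i ω := by
      rw [Finset.mul_sum]; exact Finset.sum_congr rfl fun i _ => by ring
    have a2 : ∑ i ∈ T, (α * w i) * e i ω = α * ∑ i ∈ T, w i * e i ω := by
      rw [Finset.mul_sum]; exact Finset.sum_congr rfl fun i _ => by ring
    have a3 : ∑ i ∈ S, ∑ j ∈ T, (u i * w j) * (e i ω * e j ω) =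
        (∑ i ∈ S, u i * e i ω) * ∑ i ∈ T, w i * e i ω := by
      rw [Finset.sum_mul_sum]
      exact Finset.sum_congr rfl fun i _ => Finset.sum_congr rfl fun j _ => by ring
    rw [a1, a2, a3]; ring
  simp only [e1]
  have i1 : Integrable (fun ω => α * β + ∑ i ∈ S, (β * u i) * e i ω) P :=
    (integrable_const _).add (integrable_finsetSum _ fun i _ => (hi i).const_mul _)
  have i2 : Integrable (fun ω => ∑ i ∈ T, (α * w i) * e i ω) P :=
    integrable_finsetSum _ fun i _ => (hi i).const_mul _
  have i3 : ∀ i, Integrable (fun ω => ∑ j ∈ T, (u i * w j) * (e i ω * e j ω)) P := fun i =>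
    integrable_finsetSum _ fun j _ => (hij i j).const_mul _
  have i4 : Integrable (fun ω => ∑ i ∈ T, (α * w i) * e i ω +
      ∑ i ∈ S, ∑ j ∈ T, (u i * w j) * (e i ω * e j ω)) P :=
    i2.add (integrable_finsetSum _ fun i _ => i3 i)
  rw [integral_add i1 i4,
    integral_add_sum he h0, integral_add i2 (integrable_finsetSum _ fun i _ => i3 i),
    integral_finsetSum _ fun i _ => i3 i]
  have b1 : ∫ ω, ∑ i ∈ T, (α * w i) * e i ω ∂P = 0 := by
    simpa using integral_add_sum he h0 0 (fun i => α * w i) T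
  have b2 : ∀ i ∈ S, ∫ ω, ∑ j ∈ T, (u i * w j) * (e i ω * e j ω) ∂P = u i * w i * d i := by
    intro i hiS
    rw [integral_finsetSum _ fun j _ => (hij i j).const_mul _]
    simp only [integral_const_mul, h2]
    simp [hST hiS]
  rw [b1, zero_add, Finset.sum_congr rfl b2]

namespace IsShock

theorem past_le (hξ : IsShock P ξ) (k : ℤ) : past ξ k ≤ ‹MeasurableSpace Ω› :=
  iSup₂_le fun i _ => (hξ.measurable i).comap_le

theorem indepFun_past (hξ : IsShock P ξ) {k : ℤ} {β : Type*} [MeasurableSpace β] {f : Ω → β}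
    (hf : Measurable[past ξ k] f) : IndepFun (ξ k) f P := by
  have h := indep_iSup_of_disjoint (fun i => (hξ.measurable i).comap_le) hξ.indep
    (S := {k}) (T := Set.Iio k) (by simp)
  rw [iSup_singleton] at h
  exact indep_of_indep_of_le_right h hf.comap_le

theorem memLp_apply (hξ : IsShock P ξ) (k : ℤ) : MemLp (ξ k) 2 P :=
  (hξ.ident k).memLp_iff.2 hξ.memLp

theorem integral_apply (hξ : IsShock P ξ) (k : ℤ) : ∫ ω, ξ k ω ∂P = ∫ ω, ξ 0 ω ∂P :=
  (hξ.ident k).integral_eq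

theorem variance_apply (hξ : IsShock P ξ) (k : ℤ) : Var[ξ k; P] = Var[ξ 0; P] :=
  (hξ.ident k).variance_eq

variable {k : ℤ} {V : Ω → ℝ}

theorem memLp_mul (hξ : IsShock P ξ) (hV : Measurable[past ξ k] V) (hV2 : MemLp V 2 P) :
    MemLp (fun ω => ξ k ω * V ω) 2 P :=
  memLp_two_mul_of_indepFun (hξ.indepFun_past hV) (hξ.memLp_apply k) hV2

theorem integral_sq_center_mul (hξ : IsShock P ξ) (hV : Measurable[past ξ k] V) :
    ∫ ω, ((ξ k ω - ∫ ω, ξ 0 ω ∂P) * V ω) * ((ξ k ω - ∫ ω, ξ 0 ω ∂P) * V ω) ∂P =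
      Var[ξ 0; P] * ∫ ω, V ω ^ 2 ∂P := by
  have hi : IndepFun (fun ω => (ξ k ω - ∫ ω, ξ 0 ω ∂P) ^ 2) (fun ω => V ω ^ 2) P :=
    (hξ.indepFun_past hV).comp (φ := fun x : ℝ => (x - ∫ ω, ξ 0 ω ∂P) ^ 2)
      (ψ := fun x : ℝ => x ^ 2) (by fun_prop) (by fun_prop)
  have hk := hξ.memLp_apply k
  have hVm : Measurable V := hV.mono (hξ.past_le k) le_rfl
  rw [← hξ.variance_apply k, variance_eq_integral (hξ.measurable k).aemeasurable]
  simp only [hξ.integral_apply]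
  rw [← hi.integral_fun_mul_eq_mul_integral
      ((hξ.measurable k).sub_const _ |>.pow_const 2).aestronglyMeasurable
      (hVm.pow_const 2).aestronglyMeasurable]
  congr 1
  ext ω
  ring

variable [IsProbabilityMeasure P]

theorem integral_center_mul (hξ : IsShock P ξ) (hV : Measurable[past ξ k] V) :
    ∫ ω, (ξ k ω - ∫ ω, ξ 0 ω ∂P) * V ω ∂P = 0 := by
  have hi : IndepFun (fun ω => ξ k ω - ∫ ω, ξ 0 ω ∂P) V P :=
    (hξ.indepFun_past hV).comp (φ := fun x : ℝ => x - ∫ ω, ξ 0 ω ∂P) (ψ := id)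
      (by fun_prop) measurable_id
  have hk := hξ.memLp_apply k
  rw [hi.integral_fun_mul_eq_mul_integral (hk.1.sub aestronglyMeasurable_const)
    (hV.mono (hξ.past_le k) le_rfl).aestronglyMeasurable,
    integral_sub (hk.integrable one_le_two) (integrable_const _), hξ.integral_apply]
  simp

end IsShock

end

/-! ### ARCH processes with a finite past. -/

section

variable {Ω : Type*}

/-- The ARCH process started at time `s`, with no past before `s`, at time `s + n`. -/
noncomputable def trunc (ξ : ℤ → Ω → ℝ) (a : ℝ) (b : ℕ → ℝ) (s : ℤ) : ℕ → Ω → ℝ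
  | n, ω => ξ (s + n) ω * (a + ∑ i : Fin n, b (n - i) * trunc ξ a b s i ω)
termination_by n => n
decreasing_by exact i.2

/-- The volatility at time `s + n` of the ARCH process started at time `s`. -/
noncomputable def truncVol (ξ : ℤ → Ω → ℝ) (a : ℝ) (b : ℕ → ℝ) (s : ℤ) (n : ℕ) (ω : Ω) : ℝ :=
  a + ∑ i ∈ Finset.range n, b (n - i) * trunc ξ a b s i ω

/-- The innovation at time `s + n` of the ARCH process started at time `s`. -/
noncomputable def truncInn (ξ : ℤ → Ω → ℝ) (lam a : ℝ) (b : ℕ → ℝ) (s : ℤ) (n : ℕ) (ω : Ω) : ℝ :=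
  (ξ (s + n) ω - lam) * truncVol ξ a b s n ω

variable {ξ : ℤ → Ω → ℝ} {lam a : ℝ} {b : ℕ → ℝ} (s : ℤ) (n : ℕ) (ω : Ω)

theorem trunc_eq : trunc ξ a b s n ω = ξ (s + n) ω * truncVol ξ a b s n ω := by
  rw [trunc, truncVol, Finset.sum_range]

theorem trunc_eq_fun :
    trunc ξ a b s n = fun ω => ξ (s + n) ω * truncVol ξ a b s n ω :=
  funext fun ω => trunc_eq s n ω

/-- The process equals `lam * a` plus its innovation plus the convolution of `lam * b` with itself,
and the resolvent inverts this relation. -/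
theorem trunc_eq_resolvent : trunc ξ a b s n ω =
    ∑ i ∈ Finset.range (n + 1),
      resolvent lam b (n - i) * (lam * a + truncInn ξ lam a b s i ω) := by
  refine eq_of_one_sub_mul (f := fun n => trunc ξ a b s n ω)
    (g := fun i => lam * a + truncInn ξ lam a b s i ω) (fun n => ?_) n
  have : ∑ i ∈ Finset.range n, lam * b (n - i) * trunc ξ a b s i ω =
      lam * ∑ i ∈ Finset.range n, b (n - i) * trunc ξ a b s i ω := by
    rw [Finset.mul_sum]
    exact Finset.sum_congr rfl fun i _ => mul_assoc _ _ _
  rw [this, trunc_eq, truncInn, truncVol]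
  ring

/-- The mean of the ARCH process `n` steps after its start. -/
noncomputable def truncMean (lam a : ℝ) (b : ℕ → ℝ) (n : ℕ) : ℝ :=
  lam * a * ∑ i ∈ Finset.range (n + 1), resolvent lam b i

theorem trunc_eq_mean_add : trunc ξ a b s n ω = truncMean lam a b n +
    ∑ i ∈ Finset.range (n + 1), resolvent lam b (n - i) * truncInn ξ lam a b s i ω := by
  have h := Finset.sum_range_reflect (fun i => resolvent lam b i) (n + 1)
  simp only [Nat.add_sub_cancel] at h
  rw [trunc_eq_resolvent (lam := lam), truncMean, ← h, Finset.mul_sum, ← Finset.sum_add_distrib]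
  exact Finset.sum_congr rfl fun i _ => by ring

/-- In the expansion of the process, the term `i = n` has coefficient `z 0 = 1` and is the current
innovation; what remains is `lam` times the volatility. -/
theorem mul_truncVol_eq : lam * truncVol ξ a b s n ω = truncMean lam a b n +
    ∑ i ∈ Finset.range n, resolvent lam b (n - i) * truncInn ξ lam a b s i ω := by
  have h := trunc_eq_mean_add (ξ := ξ) (lam := lam) (a := a) (b := b) s n ω
  rw [Finset.sum_range_succ, Nat.sub_self, resolvent_zero, trunc_eq, truncInn] at h
  linarith

theorem measurable_past_truncVol : Measurable[past ξ (s + n)] (truncVol ξ a b s n) := by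
  induction n using Nat.strong_induction_on with
  | _ n ih =>
    unfold truncVol
    refine Measurable.const_add (Finset.measurable_fun_sum _ fun i hi => ?_) _
    have hi' := Finset.mem_range.1 hi
    have h1 : Measurable[past ξ (s + n)] (truncVol ξ a b s i) :=
      (ih i hi').mono (past_mono (by omega)) le_rfl
    have h2 : Measurable[past ξ (s + n)] (ξ (s + i)) := measurable_past (by omega)
    rw [trunc_eq_fun]
    exact (h2.mul h1).const_mul _

variable {ω}

theorem trunc_nonneg (ha : 0 ≤ a) (hb : ∀ j, 1 ≤ j → 0 ≤ b j) (hω : ∀ k, 0 ≤ ξ k ω) :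
    0 ≤ trunc ξ a b s n ω := by
  induction n using Nat.strong_induction_on with
  | _ n ih =>
    rw [trunc_eq]
    refine mul_nonneg (hω _) (add_nonneg ha (Finset.sum_nonneg fun i hi => ?_))
    have := Finset.mem_range.1 hi
    exact mul_nonneg (hb _ (by omega)) (ih i this)

theorem le_truncVol (ha : 0 ≤ a) (hb : ∀ j, 1 ≤ j → 0 ≤ b j) (hω : ∀ k, 0 ≤ ξ k ω) :
    a ≤ truncVol ξ a b s n ω := by
  refine le_add_of_nonneg_right (Finset.sum_nonneg fun i hi => ?_)
  have := Finset.mem_range.1 hi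
  exact mul_nonneg (hb _ (by omega)) (trunc_nonneg s i ha hb hω)

/-- Starting one step earlier adds one nonnegative term to the sum and can only raise the others. -/
theorem truncVol_le_of_trunc_le (ha : 0 ≤ a) (hb : ∀ j, 1 ≤ j → 0 ≤ b j) (hω : ∀ k, 0 ≤ ξ k ω)
    (h : ∀ i < n, trunc ξ a b s i ω ≤ trunc ξ a b (s - 1) (i + 1) ω) :
    truncVol ξ a b s n ω ≤ truncVol ξ a b (s - 1) (n + 1) ω := by
  unfold truncVol
  rw [Finset.sum_range_succ']
  have h0 : 0 ≤ b (n + 1 - 0) * trunc ξ a b (s - 1) 0 ω :=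
    mul_nonneg (hb _ (by omega)) (trunc_nonneg _ _ ha hb hω)
  have h1 : ∑ i ∈ Finset.range n, b (n - i) * trunc ξ a b s i ω ≤
      ∑ i ∈ Finset.range n, b (n + 1 - (i + 1)) * trunc ξ a b (s - 1) (i + 1) ω := by
    refine Finset.sum_le_sum fun i hi => ?_
    have hi' := Finset.mem_range.1 hi
    rw [Nat.add_sub_add_right]
    exact mul_le_mul_of_nonneg_left (h i hi') (hb _ (by omega))
  linarith

theorem trunc_le (ha : 0 ≤ a) (hb : ∀ j, 1 ≤ j → 0 ≤ b j) (hω : ∀ k, 0 ≤ ξ k ω) :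
    trunc ξ a b s n ω ≤ trunc ξ a b (s - 1) (n + 1) ω := by
  induction n using Nat.strong_induction_on with
  | _ n ih =>
    rw [trunc_eq, trunc_eq, show s - 1 + ((n + 1 : ℕ) : ℤ) = s + n by push_cast; ring]
    exact mul_le_mul_of_nonneg_left (truncVol_le_of_trunc_le s n ha hb hω ih) (hω _)

theorem truncVol_le (ha : 0 ≤ a) (hb : ∀ j, 1 ≤ j → 0 ≤ b j) (hω : ∀ k, 0 ≤ ξ k ω) :
    truncVol ξ a b s n ω ≤ truncVol ξ a b (s - 1) (n + 1) ω :=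
  truncVol_le_of_trunc_le s n ha hb hω fun i _ => trunc_le s i ha hb hω

theorem monotone_trunc (ha : 0 ≤ a) (hb : ∀ j, 1 ≤ j → 0 ≤ b j) (hω : ∀ k, 0 ≤ ξ k ω) (k : ℤ) :
    Monotone fun N : ℕ => trunc ξ a b (k - N) N ω :=
  monotone_nat_of_le_succ fun N => by
    have := trunc_le (k - N) N ha hb hω
    rwa [show k - (N : ℤ) - 1 = k - ((N + 1 : ℕ) : ℤ) by push_cast; ring] at this

theorem monotone_truncVol (ha : 0 ≤ a) (hb : ∀ j, 1 ≤ j → 0 ≤ b j) (hω : ∀ k, 0 ≤ ξ k ω)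
    (k : ℤ) : Monotone fun N : ℕ => truncVol ξ a b (k - N) N ω :=
  monotone_nat_of_le_succ fun N => by
    have := truncVol_le (k - N) N ha hb hω
    rwa [show k - (N : ℤ) - 1 = k - ((N + 1 : ℕ) : ℤ) by push_cast; ring] at this

variable [MeasurableSpace Ω] {P : Measure Ω}

/-- The second moment of the volatility `n` steps after the start of the process. -/
noncomputable def volSq (P : Measure Ω) (ξ : ℤ → Ω → ℝ) (a : ℝ) (b : ℕ → ℝ) (n : ℕ) : ℝ :=
  ∫ ω, truncVol ξ a b 0 n ω ^ 2 ∂P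

namespace IsShock

theorem measurable_truncVol (hξ : IsShock P ξ) : Measurable (truncVol ξ a b s n) :=
  (measurable_past_truncVol s n).mono (hξ.past_le _) le_rfl

theorem measurable_trunc (hξ : IsShock P ξ) : Measurable (trunc ξ a b s n) := by
  rw [trunc_eq_fun]
  exact (hξ.measurable _).mul (hξ.measurable_truncVol s n)

theorem ae_nonneg (hξ : IsShock P ξ) : ∀ᵐ ω ∂P, ∀ k, 0 ≤ ξ k ω :=
  ae_all_iff.2 hξ.nonneg

variable [IsProbabilityMeasure P]

theorem memLp_truncVol (hξ : IsShock P ξ) : MemLp (truncVol ξ a b s n) 2 P := by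
  induction n using Nat.strong_induction_on with
  | _ n ih =>
    unfold truncVol
    refine (memLp_const a).add (memLp_finsetSum _ fun i hi => ?_)
    rw [trunc_eq_fun]
    exact (hξ.memLp_mul (measurable_past_truncVol s i) (ih i (Finset.mem_range.1 hi))).const_mul _

theorem memLp_trunc (hξ : IsShock P ξ) : MemLp (trunc ξ a b s n) 2 P := by
  rw [trunc_eq_fun]
  exact hξ.memLp_mul (measurable_past_truncVol s n) (hξ.memLp_truncVol s n)

theorem memLp_truncInn (hξ : IsShock P ξ) (lam : ℝ) : MemLp (truncInn ξ lam a b s n) 2 P := by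
  have := (hξ.memLp_trunc (a := a) (b := b) s n).sub
    ((hξ.memLp_truncVol (a := a) (b := b) s n).const_mul lam)
  refine (memLp_congr_ae (Eventually.of_forall fun ω => ?_)).1 this
  simp only [Pi.sub_apply, trunc_eq, truncInn]
  ring

theorem integral_truncInn (hξ : IsShock P ξ) (hlam : lam = ∫ ω, ξ 0 ω ∂P) :
    ∫ ω, truncInn ξ lam a b s n ω ∂P = 0 := by
  rw [hlam]
  exact hξ.integral_center_mul (measurable_past_truncVol s n)

/-- Everything except the later centred shock is measurable with respect to the past of that shock.
-/
theorem integral_truncInn_mul_of_lt (hξ : IsShock P ξ) (hlam : lam = ∫ ω, ξ 0 ω ∂P) {i j : ℕ}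
    (hij : i < j) : ∫ ω, truncInn ξ lam a b s i ω * truncInn ξ lam a b s j ω ∂P = 0 := by
  have h1 : Measurable[past ξ (s + j)] (truncInn ξ lam a b s i) := by
    have h2 : Measurable[past ξ (s + j)] (truncVol ξ a b s i) :=
      (measurable_past_truncVol s i).mono (past_mono (by omega)) le_rfl
    have h3 : Measurable[past ξ (s + j)] (ξ (s + i)) := measurable_past (by omega)
    exact (h3.sub_const lam).mul h2
  have h4 := hξ.integral_center_mul
    (h1.mul (measurable_past_truncVol (ξ := ξ) (a := a) (b := b) s j))
  rw [← hlam] at h4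
  rw [← h4]
  congr 1
  ext ω
  simp only [truncInn, Pi.mul_apply]
  ring

theorem integral_truncInn_mul (hξ : IsShock P ξ) (hlam : lam = ∫ ω, ξ 0 ω ∂P) (i j : ℕ) :
    ∫ ω, truncInn ξ lam a b s i ω * truncInn ξ lam a b s j ω ∂P =
      if i = j then Var[ξ 0; P] * ∫ ω, truncVol ξ a b s i ω ^ 2 ∂P else 0 := by
  rcases lt_trichotomy i j with h | rfl | h
  · rw [if_neg h.ne, hξ.integral_truncInn_mul_of_lt s hlam h]
  · rw [if_pos rfl, hlam]
    exact hξ.integral_sq_center_mul (measurable_past_truncVol s i)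
  · rw [if_neg h.ne']
    simp only [mul_comm (truncInn ξ lam a b s i _)]
    exact hξ.integral_truncInn_mul_of_lt s hlam h

theorem mul_integral_truncVol_sq (hξ : IsShock P ξ) (hlam : lam = ∫ ω, ξ 0 ω ∂P) :
    lam ^ 2 * ∫ ω, truncVol ξ a b s n ω ^ 2 ∂P = truncMean lam a b n ^ 2 +
      ∑ i ∈ Finset.range n, resolvent lam b (n - i) ^ 2 *
        (Var[ξ 0; P] * ∫ ω, truncVol ξ a b s i ω ^ 2 ∂P) := by
  have h := integral_mul_add_sum (fun i => hξ.memLp_truncInn s i lam)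
    (fun i => hξ.integral_truncInn s i hlam) (hξ.integral_truncInn_mul (a := a) (b := b) s hlam)
    (truncMean lam a b n) (truncMean lam a b n) (fun i => resolvent lam b (n - i))
    (fun i => resolvent lam b (n - i)) (Finset.Subset.refl (Finset.range n))
  simp only [← mul_truncVol_eq] at h
  simp only [sq, ← integral_const_mul] at h ⊢
  rw [← h]
  congr 1
  ext ω
  ring

/-- The recursion for the second moments does not involve `s`, so induction suffices and no shift
invariance of the joint law is needed. -/
theorem integral_truncVol_sq (hξ : IsShock P ξ) :
    ∫ ω, truncVol ξ a b s n ω ^ 2 ∂P = volSq P ξ a b n := by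
  have hl := hξ.mean_pos
  induction n using Nat.strong_induction_on with
  | _ n ih =>
    have h1 := hξ.mul_integral_truncVol_sq (a := a) (b := b) s n rfl
    have h2 := hξ.mul_integral_truncVol_sq (a := a) (b := b) 0 n rfl
    have h3 : ∀ i ∈ Finset.range n, ∫ ω, truncVol ξ a b s i ω ^ 2 ∂P =
        ∫ ω, truncVol ξ a b 0 i ω ^ 2 ∂P := fun i hi => ih i (Finset.mem_range.1 hi)
    rw [Finset.sum_congr rfl fun i hi => by rw [h3 i hi], ← h2] at h1
    exact mul_left_cancel₀ (by positivity) h1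

theorem volSq_rec (hξ : IsShock P ξ) (hlam : lam = ∫ ω, ξ 0 ω ∂P) :
    lam ^ 2 * volSq P ξ a b n = truncMean lam a b n ^ 2 +
      ∑ i ∈ Finset.range n, resolvent lam b (n - i) ^ 2 * (Var[ξ 0; P] * volSq P ξ a b i) :=
  hξ.mul_integral_truncVol_sq 0 n hlam

theorem integral_trunc (hξ : IsShock P ξ) (hlam : lam = ∫ ω, ξ 0 ω ∂P) :
    ∫ ω, trunc ξ a b s n ω ∂P = truncMean lam a b n := by
  simp only [trunc_eq_mean_add (lam := lam) s n]
  exact integral_add_sum (fun i => hξ.memLp_truncInn s i lam)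
    (fun i => hξ.integral_truncInn s i hlam) _ _ _

theorem integral_trunc_mul (hξ : IsShock P ξ) (hlam : lam = ∫ ω, ξ 0 ω ∂P) (p : ℕ) :
    ∫ ω, trunc ξ a b s n ω * trunc ξ a b s (n + p) ω ∂P =
      truncMean lam a b n * truncMean lam a b (n + p) + ∑ j ∈ Finset.range (n + 1),
        resolvent lam b j * resolvent lam b (j + p) * (Var[ξ 0; P] * volSq P ξ a b (n - j)) := by
  simp only [trunc_eq_mean_add (lam := lam) s]
  rw [integral_mul_add_sum (fun i => hξ.memLp_truncInn s i lam)
    (fun i => hξ.integral_truncInn s i hlam) (hξ.integral_truncInn_mul (a := a) (b := b) s hlam)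
    _ _ (fun i => resolvent lam b (n - i)) (fun i => resolvent lam b (n + p - i))
    (Finset.range_subset_range.2 (by omega))]
  congr 1
  rw [← Finset.sum_range_reflect]
  refine Finset.sum_congr rfl fun i hi => ?_
  have := Finset.mem_range.1 hi
  rw [hξ.integral_truncVol_sq, show n + 1 - 1 - i = n - i by omega,
    show n - (n - i) = i by omega, show n + p - (n - i) = i + p by omega]

theorem integral_truncInn_sq (hξ : IsShock P ξ) (hlam : lam = ∫ ω, ξ 0 ω ∂P) :
    ∫ ω, truncInn ξ lam a b s n ω ^ 2 ∂P = Var[ξ 0; P] * volSq P ξ a b n := by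
  simp only [sq]
  rw [hξ.integral_truncInn_mul s hlam, if_pos rfl, hξ.integral_truncVol_sq]

theorem sq_le_volSq (hξ : IsShock P ξ) (ha : 0 ≤ a) (hb : ∀ j, 1 ≤ j → 0 ≤ b j) :
    a ^ 2 ≤ volSq P ξ a b n := by
  have : ∫ _, a ^ 2 ∂P ≤ volSq P ξ a b n :=
    integral_mono_ae (integrable_const _) (hξ.memLp_truncVol 0 n).integrable_sq
      (hξ.ae_nonneg.mono fun ω hω => pow_le_pow_left₀ ha (le_truncVol 0 n ha hb hω) 2)
  simpa using this

theorem monotone_volSq (hξ : IsShock P ξ) (ha : 0 ≤ a) (hb : ∀ j, 1 ≤ j → 0 ≤ b j) :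
    Monotone (volSq P ξ a b) :=
  monotone_nat_of_le_succ fun n => by
    rw [← hξ.integral_truncVol_sq (0 - 1) (n + 1)]
    refine integral_mono_ae (hξ.memLp_truncVol 0 n).integrable_sq
      (hξ.memLp_truncVol _ _).integrable_sq (hξ.ae_nonneg.mono fun ω hω => ?_)
    exact pow_le_pow_left₀ (ha.trans (le_truncVol 0 n ha hb hω)) (truncVol_le 0 n ha hb hω) 2

/-- The recursion gives `v n ≤ M + w * max v i` over `i < n`, where `w = Ω² < 1` and `M` bounds the
squared mean divided by `lam ^ 2`. The bound `M / (1 - w)` is the fixed point. -/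
theorem exists_volSq_le (hξ : IsShock P ξ) (hlam : lam = ∫ ω, ξ 0 ω ∂P) (ha : 0 ≤ a)
    (hb : ∀ j, 1 ≤ j → 0 ≤ b j) (hz : Summable (resolvent lam b))
    (hΩ : bigOmega lam (Real.sqrt (Var[ξ 0; P])) b < 1) :
    ∃ C, ∀ n, volSq P ξ a b n ≤ C := by
  have hl : 0 < lam := hlam ▸ hξ.mean_pos
  have hv := hξ.variance_pos
  have hz0 := resolvent_nonneg hl.le hb
  have hz2 : Summable fun j => resolvent lam b (j + 1) ^ 2 := by
    refine Summable.of_nonneg_of_le (fun j => sq_nonneg _) (fun j => ?_)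
      (((summable_nat_add_iff 1).2 hz).mul_left (∑' i, resolvent lam b i))
    rw [sq]
    exact mul_le_mul_of_nonneg_right (hz.le_tsum _ fun i _ => hz0 i) (hz0 _)
  set w := (Var[ξ 0; P] / lam ^ 2) * ∑' j, resolvent lam b (j + 1) ^ 2 with hw
  have hw0 : 0 ≤ w := mul_nonneg (by positivity) (tsum_nonneg fun j => sq_nonneg _)
  have hw1 : w < 1 := by
    have h1 : bigOmega lam (Real.sqrt (Var[ξ 0; P])) b ^ 2 = w := by
      rw [bigOmega, mul_pow, div_pow, Real.sq_sqrt hv.le,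
        Real.sq_sqrt (tsum_nonneg fun j => sq_nonneg _)]
    have h0 : 0 ≤ bigOmega lam (Real.sqrt (Var[ξ 0; P])) b := by
      unfold bigOmega; positivity
    rw [← h1]
    exact pow_lt_one₀ h0 hΩ two_ne_zero
  set M := (a * ∑' i, resolvent lam b i) ^ 2 with hM
  have h1w : 0 < 1 - w := by linarith
  refine ⟨M / (1 - w), fun n => ?_⟩
  induction n using Nat.strong_induction_on with
  | _ n ih =>
    have hC : 0 ≤ M / (1 - w) := by positivity
    have h1 : truncMean lam a b n ^ 2 ≤ lam ^ 2 * M := by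
      rw [hM, ← mul_pow, truncMean, mul_assoc lam]
      have h0 := Finset.sum_nonneg fun i (_ : i ∈ Finset.range (n + 1)) => hz0 i
      refine pow_le_pow_left₀ (by positivity) ?_ 2
      gcongr
      exact hz.sum_le_tsum _ fun i _ => hz0 i
    have h2 : ∑ i ∈ Finset.range n, resolvent lam b (n - i) ^ 2 *
        (Var[ξ 0; P] * volSq P ξ a b i) ≤ lam ^ 2 * (w * (M / (1 - w))) := by
      calc _ ≤ ∑ i ∈ Finset.range n, resolvent lam b (n - i) ^ 2 *
            (Var[ξ 0; P] * (M / (1 - w))) := by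
            refine Finset.sum_le_sum fun i hi => ?_
            gcongr
            exact ih i (Finset.mem_range.1 hi)
        _ = (∑ i ∈ Finset.range n, resolvent lam b (i + 1) ^ 2) *
            (Var[ξ 0; P] * (M / (1 - w))) := by
            rw [← Finset.sum_mul, ← Finset.sum_range_reflect]
            congr 1
            refine Finset.sum_congr rfl fun i hi => ?_
            have := Finset.mem_range.1 hi
            rw [show n - (n - 1 - i) = i + 1 by omega]
        _ ≤ (∑' i, resolvent lam b (i + 1) ^ 2) * (Var[ξ 0; P] * (M / (1 - w))) := by
            gcongr
            exact hz2.sum_le_tsum _ fun i _ => sq_nonneg _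
        _ = _ := by rw [hw]; field_simp
    have h3 := hξ.volSq_rec (a := a) (b := b) n hlam
    have h4 : M + w * (M / (1 - w)) = M / (1 - w) := by field_simp; ring
    have h5 : lam ^ 2 * volSq P ξ a b n ≤ lam ^ 2 * (M / (1 - w)) := by
      rw [h3, ← h4, mul_add]
      exact add_le_add h1 h2
    exact le_of_mul_le_mul_left h5 (by positivity)

end IsShock

end

/-! ### The causal stationary solution and its moments. -/

section

variable {Ω : Type*}

/-- The causal solution of the ARCH(∞) equations: the increasing limit of the processes started
ever earlier. -/
noncomputable def archSol (ξ : ℤ → Ω → ℝ) (a : ℝ) (b : ℕ → ℝ) (k : ℤ) (ω : Ω) : ℝ :=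
  ⨆ N : ℕ, trunc ξ a b (k - N) N ω

variable {ξ : ℤ → Ω → ℝ} {lam a : ℝ} {b : ℕ → ℝ} {ω : Ω}

theorem tendsto_trunc (ha : 0 ≤ a) (hb : ∀ j, 1 ≤ j → 0 ≤ b j) (hω : ∀ k, 0 ≤ ξ k ω) {k : ℤ}
    (hbdd : BddAbove (Set.range fun N : ℕ => trunc ξ a b (k - N) N ω)) :
    Tendsto (fun N : ℕ => trunc ξ a b (k - N) N ω) atTop (𝓝 (archSol ξ a b k ω)) :=
  tendsto_atTop_ciSup (monotone_trunc ha hb hω k) hbdd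

/-- Indexed by lag, each summand is a finite-past process whose start recedes with `N`; padding with
zeros gives a series to which dominated convergence applies. -/
theorem truncVol_eq_tsum (k : ℤ) (N : ℕ) : truncVol ξ a b (k - N) N ω =
    a + ∑' j : ℕ, if j < N then
      b (j + 1) * trunc ξ a b (k - ((j : ℤ) + 1) - (N - 1 - j : ℕ)) (N - 1 - j) ω else 0 := by
  rw [truncVol, tsum_eq_sum (s := Finset.range N) fun j hj => if_neg (by simpa using hj),
    ← Finset.sum_range_reflect]
  congr 1
  refine Finset.sum_congr rfl fun j hj => ?_
  have hj' := Finset.mem_range.1 hj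
  rw [if_pos hj', show N - (N - 1 - j) = j + 1 by omega,
    show k - ((j : ℤ) + 1) - (N - 1 - j : ℕ) = k - N by omega]

theorem tendsto_truncVol (ha : 0 ≤ a) (hb : ∀ j, 1 ≤ j → 0 ≤ b j) (hω : ∀ k, 0 ≤ ξ k ω)
    (hbdd : ∀ k : ℤ, BddAbove (Set.range fun N : ℕ => trunc ξ a b (k - N) N ω)) {k : ℤ}
    (hs : Summable fun j : ℕ => b (j + 1) * archSol ξ a b (k - ((j : ℤ) + 1)) ω) :
    Tendsto (fun N : ℕ => truncVol ξ a b (k - N) N ω) atTop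
      (𝓝 (volatility a b (archSol ξ a b) k ω)) := by
  simp only [truncVol_eq_tsum]
  refine (tendsto_tsum_of_dominated_convergence hs (fun j => ?_) ?_).const_add a
  · have h1 := ((tendsto_trunc ha hb hω (hbdd (k - ((j : ℤ) + 1)))).const_mul (b (j + 1))).comp
      (tendsto_sub_atTop_nat (j + 1))
    refine h1.congr' ?_
    filter_upwards [eventually_gt_atTop j] with N hN
    rw [if_pos hN, Nat.sub_sub, add_comm 1 j, Function.comp]
  -- By monotonicity the limiting terms themselves dominate.
  · refine Eventually.of_forall fun N j => ?_
    have h0 : 0 ≤ b (j + 1) * trunc ξ a b (k - ((j : ℤ) + 1) - (N - 1 - j : ℕ)) (N - 1 - j) ω :=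
      mul_nonneg (hb _ (by omega)) (trunc_nonneg _ _ ha hb hω)
    have h1 : b (j + 1) * trunc ξ a b (k - ((j : ℤ) + 1) - (N - 1 - j : ℕ)) (N - 1 - j) ω ≤
        b (j + 1) * archSol ξ a b (k - ((j : ℤ) + 1)) ω :=
      mul_le_mul_of_nonneg_left (le_ciSup (hbdd (k - ((j : ℤ) + 1))) (N - 1 - j))
        (hb _ (by omega))
    split_ifs
    · rwa [Real.norm_of_nonneg h0]
    · simpa using h0.trans h1

theorem truncMean_tendsto (hz : Summable (resolvent lam b)) (a : ℝ) :
    Tendsto (truncMean lam a b) atTop (𝓝 (lam * a * ∑' i, resolvent lam b i)) :=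
  (hz.hasSum.tendsto_sum_nat.comp (tendsto_add_atTop_nat 1)).const_mul _

variable [MeasurableSpace Ω] {P : Measure Ω}

namespace IsShock

theorem measurable_archSol (hξ : IsShock P ξ) (k : ℤ) : Measurable (archSol ξ a b k) :=
  Measurable.iSup fun _ => hξ.measurable_trunc _ _

variable [IsProbabilityMeasure P]

theorem ae_bddAbove_trunc (hξ : IsShock P ξ) (ha : 0 ≤ a) (hb : ∀ j, 1 ≤ j → 0 ≤ b j)
    (hz : Summable (resolvent (∫ ω, ξ 0 ω ∂P) b)) :
    ∀ᵐ ω ∂P, ∀ k : ℤ, BddAbove (Set.range fun N : ℕ => trunc ξ a b (k - N) N ω) := by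
  refine ae_all_iff.2 fun k => ?_
  obtain ⟨C, hC⟩ := (truncMean_tendsto hz a).bddAbove_range
  refine ae_bddAbove_of_integral_le (C := C)
    (fun N => (hξ.memLp_trunc (k - N) N).integrable one_le_two)
    (hξ.ae_nonneg.mono fun ω hω N => trunc_nonneg _ _ ha hb hω)
    (hξ.ae_nonneg.mono fun ω hω => monotone_trunc ha hb hω k) fun N => ?_
  rw [hξ.integral_trunc _ _ rfl]
  exact hC (Set.mem_range_self N)

theorem integral_archSol (hξ : IsShock P ξ) (ha : 0 ≤ a) (hb : ∀ j, 1 ≤ j → 0 ≤ b j)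
    (hlam : lam = ∫ ω, ξ 0 ω ∂P) (hz : Summable (resolvent lam b)) (k : ℤ) :
    Integrable (archSol ξ a b k) P ∧
      ∫ ω, archSol ξ a b k ω ∂P = lam * a * ∑' i, resolvent lam b i := by
  refine integrable_and_integral_eq_of_monotone
    (fun N => (hξ.memLp_trunc (k - N) N).integrable one_le_two)
    (hξ.ae_nonneg.mono fun ω hω N => trunc_nonneg _ _ ha hb hω)
    (hξ.ae_nonneg.mono fun ω hω => monotone_trunc ha hb hω k) ?_ ?_
  · filter_upwards [hξ.ae_nonneg, hξ.ae_bddAbove_trunc ha hb (hlam ▸ hz)] with ω h1 h2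
    exact tendsto_trunc ha hb h1 (h2 k)
  · simp only [hξ.integral_trunc _ _ hlam]
    exact truncMean_tendsto hz a

theorem ae_summable_archSol (hξ : IsShock P ξ) (ha : 0 ≤ a) (hb : ∀ j, 1 ≤ j → 0 ≤ b j)
    (hz : Summable (resolvent (∫ ω, ξ 0 ω ∂P) b)) (hbs : Summable fun j : ℕ => b (j + 1)) :
    ∀ᵐ ω ∂P, ∀ k : ℤ,
      Summable fun j : ℕ => b (j + 1) * archSol ξ a b (k - ((j : ℤ) + 1)) ω := by
  refine ae_all_iff.2 fun k => ?_
  refine ae_summable_of_integral_norm_le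
    (fun j => (hξ.integral_archSol ha hb rfl hz (k - ((j : ℤ) + 1))).1.const_mul _) (fun j => ?_)
    (hbs.mul_right ((∫ ω, ξ 0 ω ∂P) * a * ∑' i, resolvent (∫ ω, ξ 0 ω ∂P) b i))
  rw [← (hξ.integral_archSol ha hb rfl hz (k - ((j : ℤ) + 1))).2, ← integral_const_mul]
  refine (integral_congr_ae ?_).le
  filter_upwards [hξ.ae_nonneg] with ω h1
  exact Real.norm_of_nonneg (mul_nonneg (hb _ (by omega))
    (Real.iSup_nonneg fun N => trunc_nonneg _ _ ha hb h1))

theorem ae_archSol (hξ : IsShock P ξ) (ha : 0 ≤ a) (hb : ∀ j, 1 ≤ j → 0 ≤ b j)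
    (hz : Summable (resolvent (∫ ω, ξ 0 ω ∂P) b)) (hbs : Summable fun j : ℕ => b (j + 1)) :
    ∀ᵐ ω ∂P, ∀ k : ℤ,
      Tendsto (fun N : ℕ => trunc ξ a b (k - N) N ω) atTop (𝓝 (archSol ξ a b k ω)) ∧
      Tendsto (fun N : ℕ => truncVol ξ a b (k - N) N ω) atTop
        (𝓝 (volatility a b (archSol ξ a b) k ω)) ∧
      Summable (fun j : ℕ => b (j + 1) * archSol ξ a b (k - ((j : ℤ) + 1)) ω) ∧
      archSol ξ a b k ω = volatility a b (archSol ξ a b) k ω * ξ k ω := by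
  filter_upwards [hξ.ae_nonneg, hξ.ae_bddAbove_trunc ha hb hz,
    hξ.ae_summable_archSol ha hb hz hbs] with ω h1 h2 h3 k
  have t1 := tendsto_trunc ha hb h1 (h2 k)
  have t2 := tendsto_truncVol ha hb h1 h2 (h3 k)
  refine ⟨t1, t2, h3 k, tendsto_nhds_unique t1 ((t2.mul_const (ξ k ω)).congr fun N => ?_)⟩
  rw [trunc_eq, sub_add_cancel, mul_comm]

theorem solvesArch_archSol (hξ : IsShock P ξ) (ha : 0 ≤ a) (hb : ∀ j, 1 ≤ j → 0 ≤ b j)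
    (hz : Summable (resolvent (∫ ω, ξ 0 ω ∂P) b)) (hbs : Summable fun j : ℕ => b (j + 1)) :
    SolvesArch P ξ a b (archSol ξ a b) :=
  (hξ.ae_archSol ha hb hz hbs).mono fun _ h k => (h k).2.2

variable {v : ℝ}

theorem tendsto_integral_trunc_mul (hξ : IsShock P ξ) (ha : 0 ≤ a) (hb : ∀ j, 1 ≤ j → 0 ≤ b j)
    (hlam : lam = ∫ ω, ξ 0 ω ∂P) (hz : Summable (resolvent lam b))
    (hv : Tendsto (volSq P ξ a b) atTop (𝓝 v)) (k : ℤ) (p : ℕ) :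
    Tendsto (fun N : ℕ => ∫ ω, trunc ξ a b (k - N) N ω * trunc ξ a b (k - N) (N + p) ω ∂P) atTop
      (𝓝 ((lam * a * ∑' i, resolvent lam b i) * (lam * a * ∑' i, resolvent lam b i) +
        Var[ξ 0; P] * v * ∑' j, resolvent lam b j * resolvent lam b (j + p))) := by
  simp only [hξ.integral_trunc_mul _ _ hlam]
  have hz0 := resolvent_nonneg (hlam ▸ hξ.mean_pos).le hb
  refine ((truncMean_tendsto hz a).mul
    ((truncMean_tendsto hz a).comp (tendsto_add_atTop_nat p))).add ?_
  have e1 : ∀ n, ∑ j ∈ Finset.range (n + 1),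
      resolvent lam b j * resolvent lam b (j + p) * (Var[ξ 0; P] * volSq P ξ a b (n - j)) =
      ∑' j, if j < n + 1 then
        resolvent lam b j * resolvent lam b (j + p) * (Var[ξ 0; P] * volSq P ξ a b (n - j))
        else 0 := fun n => by
    rw [tsum_eq_sum (s := Finset.range (n + 1)) fun j hj => if_neg (by simpa using hj)]
    exact Finset.sum_congr rfl fun j hj => (if_pos (Finset.mem_range.1 hj)).symm
  simp only [e1]
  rw [mul_comm, ← tsum_mul_right]
  -- Monotonicity bounds every `volSq` by its limit `v`, which supplies the dominating sequence.
  have hvle : ∀ n, volSq P ξ a b n ≤ v := fun n => (hξ.monotone_volSq ha hb).ge_of_tendsto hv n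
  have hv0 : ∀ n, 0 ≤ volSq P ξ a b n := fun n => (sq_nonneg a).trans (hξ.sq_le_volSq n ha hb)
  have hσ := hξ.variance_pos
  refine tendsto_tsum_of_dominated_convergence
    (bound := fun j => resolvent lam b j * ((∑' i, resolvent lam b i) * (Var[ξ 0; P] * v)))
    (hz.mul_right _) (fun j => ?_) (Eventually.of_forall fun n j => ?_)
  · have h1 := ((hv.comp (tendsto_sub_atTop_nat j)).const_mul (Var[ξ 0; P])).const_mul
      (resolvent lam b j * resolvent lam b (j + p))
    refine h1.congr' ?_
    filter_upwards [eventually_ge_atTop j] with n hn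
    rw [if_pos (by omega), Function.comp]
  · have hZ : resolvent lam b (j + p) ≤ ∑' i, resolvent lam b i := hz.le_tsum _ fun i _ => hz0 i
    have h1 := hz0 j
    have h2 := hz0 (j + p)
    have h3 := hv0 (n - j)
    have h4 := hv0 0 |>.trans (hvle 0)
    split_ifs
    · rw [Real.norm_of_nonneg (by positivity), mul_assoc]
      gcongr
      · exact h2.trans hZ
      · exact hvle _
    · have := h2.trans hZ
      simp only [norm_zero]
      positivity

theorem integral_archSol_mul (hξ : IsShock P ξ) (ha : 0 ≤ a) (hb : ∀ j, 1 ≤ j → 0 ≤ b j)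
    (hlam : lam = ∫ ω, ξ 0 ω ∂P) (hz : Summable (resolvent lam b))
    (hbs : Summable fun j : ℕ => b (j + 1))
    (hv : Tendsto (volSq P ξ a b) atTop (𝓝 v)) (k : ℤ) (p : ℕ) :
    Integrable (fun ω => archSol ξ a b k ω * archSol ξ a b (k + p) ω) P ∧
    ∫ ω, archSol ξ a b k ω * archSol ξ a b (k + p) ω ∂P =
      (lam * a * ∑' i, resolvent lam b i) * (lam * a * ∑' i, resolvent lam b i) +
        Var[ξ 0; P] * v * ∑' j, resolvent lam b j * resolvent lam b (j + p) := by
  -- Both factors share the start `k - N`, as the orthogonal expansion requires; seen from time `k +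
  -- p`, that start lies `N + p` steps back.
  have hshift : ∀ N : ℕ, k - (N : ℤ) = k + p - (N + p : ℕ) := fun N => by push_cast; ring
  refine integrable_and_integral_eq_of_monotone
    (fun N : ℕ => (hξ.memLp_trunc (k - N) N).integrable_mul (hξ.memLp_trunc (k - N) (N + p)))
    (hξ.ae_nonneg.mono fun ω hω N => mul_nonneg (trunc_nonneg _ _ ha hb hω)
      (trunc_nonneg _ _ ha hb hω)) ?_ ?_ (hξ.tendsto_integral_trunc_mul ha hb hlam hz hv k p)
  · filter_upwards [hξ.ae_nonneg] with ω hω i j hij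
    refine mul_le_mul (monotone_trunc ha hb hω k hij) ?_ (trunc_nonneg _ _ ha hb hω)
      (trunc_nonneg _ _ ha hb hω)
    rw [hshift i, hshift j]
    exact monotone_trunc ha hb hω (k + p) (by omega)
  · filter_upwards [hξ.ae_archSol ha hb (hlam ▸ hz) hbs] with ω hω
    refine (hω k).1.mul (((hω (k + p)).1.comp (tendsto_add_atTop_nat p)).congr fun N => ?_)
    simp only [Function.comp, ← hshift N]

theorem integral_innovation_sq (hξ : IsShock P ξ) (ha : 0 ≤ a) (hb : ∀ j, 1 ≤ j → 0 ≤ b j)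
    (hlam : lam = ∫ ω, ξ 0 ω ∂P) (hz : Summable (resolvent lam b))
    (hbs : Summable fun j : ℕ => b (j + 1))
    (hv : Tendsto (volSq P ξ a b) atTop (𝓝 v)) (k : ℤ) :
    Integrable (fun ω => innovation lam a b (archSol ξ a b) k ω ^ 2) P ∧
    ∫ ω, innovation lam a b (archSol ξ a b) k ω ^ 2 ∂P = Var[ξ 0; P] * v := by
  refine integrable_and_integral_eq_of_monotone
    (f := fun (N : ℕ) ω => truncInn ξ lam a b (k - N) N ω ^ 2)
    (fun N => (hξ.memLp_truncInn (k - N) N lam).integrable_sq)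
    (Eventually.of_forall fun ω N => sq_nonneg _) ?_ ?_ ?_
  -- The innovations are signed and need not be monotone in `N`, but their squares are a fixed
  -- square times an increasing squared volatility.
  · filter_upwards [hξ.ae_nonneg] with ω hω i j hij
    simp only [truncInn, sub_add_cancel, mul_pow]
    exact mul_le_mul_of_nonneg_left (pow_le_pow_left₀ (ha.trans (le_truncVol _ _ ha hb hω))
      (monotone_truncVol ha hb hω k hij) 2) (sq_nonneg _)
  · filter_upwards [hξ.ae_archSol ha hb (hlam ▸ hz) hbs] with ω hω
    have h1 : innovation lam a b (archSol ξ a b) k ω =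
        (ξ k ω - lam) * volatility a b (archSol ξ a b) k ω := by
      rw [innovation, (hω k).2.2.2]
      ring
    rw [h1]
    simp only [truncInn, sub_add_cancel]
    exact ((hω k).2.1.const_mul _).pow 2
  · simp only [hξ.integral_truncInn_sq _ _ hlam]
    exact hv.const_mul _

theorem memLp_archSol (hξ : IsShock P ξ) (ha : 0 ≤ a) (hb : ∀ j, 1 ≤ j → 0 ≤ b j)
    (hlam : lam = ∫ ω, ξ 0 ω ∂P) (hz : Summable (resolvent lam b))
    (hbs : Summable fun j : ℕ => b (j + 1))
    (hv : Tendsto (volSq P ξ a b) atTop (𝓝 v)) (k : ℤ) : MemLp (archSol ξ a b k) 2 P := by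
  refine (memLp_two_iff_integrable_sq (hξ.measurable_archSol k).aestronglyMeasurable).2 ?_
  simpa [sq] using (hξ.integral_archSol_mul ha hb hlam hz hbs hv k 0).1

theorem cov_archSol (hξ : IsShock P ξ) (ha : 0 ≤ a) (hb : ∀ j, 1 ≤ j → 0 ≤ b j)
    (hlam : lam = ∫ ω, ξ 0 ω ∂P) (hz : Summable (resolvent lam b))
    (hbs : Summable fun j : ℕ => b (j + 1))
    (hv : Tendsto (volSq P ξ a b) atTop (𝓝 v)) (k : ℤ) (p : ℕ) :
    cov[archSol ξ a b k, archSol ξ a b (k + p); P] =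
      Var[ξ 0; P] * v * ∑' j, resolvent lam b j * resolvent lam b (j + p) := by
  rw [covariance_eq_sub (hξ.memLp_archSol ha hb hlam hz hbs hv _)
    (hξ.memLp_archSol ha hb hlam hz hbs hv _), (hξ.integral_archSol ha hb hlam hz k).2,
    (hξ.integral_archSol ha hb hlam hz (k + p)).2]
  simp only [Pi.mul_apply]
  rw [(hξ.integral_archSol_mul ha hb hlam hz hbs hv k p).2]
  ring

theorem isWeaklyStationary_archSol (hξ : IsShock P ξ) (ha : 0 ≤ a) (hb : ∀ j, 1 ≤ j → 0 ≤ b j)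
    (hlam : lam = ∫ ω, ξ 0 ω ∂P) (hz : Summable (resolvent lam b))
    (hbs : Summable fun j : ℕ => b (j + 1))
    (hv : Tendsto (volSq P ξ a b) atTop (𝓝 v)) : IsWeaklyStationary P (archSol ξ a b) where
  measurable := hξ.measurable_archSol
  memLp := hξ.memLp_archSol ha hb hlam hz hbs hv
  mean k := by
    rw [(hξ.integral_archSol ha hb hlam hz k).2, (hξ.integral_archSol ha hb hlam hz 0).2]
  cov n k := by
    have hcov := hξ.cov_archSol ha hb hlam hz hbs hv
    unfold autocov
    obtain ⟨p, rfl | rfl⟩ := k.eq_nat_or_neg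
    · have h0 := hcov 0 p
      rw [zero_add] at h0
      rw [hcov, h0]
    · have h1 := hcov (n + -p) p
      have h2 := hcov (-p) p
      rw [neg_add_cancel_right] at h1
      rw [neg_add_cancel] at h2
      rw [covariance_comm, h1, covariance_comm, h2]

end IsShock

end

/-! ### Uniqueness of weakly stationary solutions. -/

section

open scoped ENNReal

variable {Ω : Type*}

/-- The `n`-fold Volterra term of the ARCH(∞) equations with weights `ρ ^ j`. -/
noncomputable def shockChain (ξ : ℤ → Ω → ℝ) (b : ℕ → ℝ) (ρ : ℝ) : ℕ → ℤ → Ω → ℝ≥0∞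
  | 0, _, _ => 1
  | n + 1, k, ω => ENNReal.ofReal (ξ k ω) *
      ∑' j : ℕ, ENNReal.ofReal (b (j + 1) * ρ ^ (j + 1)) *
        shockChain ξ b ρ n (k - ((j : ℤ) + 1)) ω

variable {ξ : ℤ → Ω → ℝ} {b : ℕ → ℝ} {ρ : ℝ}

theorem measurable_past_sum_of_shockChain {n : ℕ}
    (h : ∀ k, Measurable[past ξ (k + 1)] (shockChain ξ b ρ n k)) (k : ℤ) :
    Measurable[past ξ k] fun ω => ∑' j : ℕ, ENNReal.ofReal (b (j + 1) * ρ ^ (j + 1)) *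
        shockChain ξ b ρ n (k - ((j : ℤ) + 1)) ω :=
  letI := past ξ k
  Measurable.tsum fun j => ((h _).mono (past_mono (by omega)) le_rfl).const_mul _

theorem measurable_past_shockChain (n : ℕ) (k : ℤ) :
    Measurable[past ξ (k + 1)] (shockChain ξ b ρ n k) := by
  induction n generalizing k with
  | zero => exact @measurable_const _ _ _ (past ξ (k + 1)) 1
  | succ n ih =>
    have h1 : Measurable[past ξ (k + 1)] (ξ k) := measurable_past (by omega)
    exact h1.ennreal_ofReal.mul
      ((measurable_past_sum_of_shockChain ih k).mono (past_mono (by omega)) le_rfl)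

/-- Each use of the recursion moves `j + 1` steps further back, where the growth bound is larger by
`ρ ^ (j + 1)`; the weights of the chain absorb this factor. All `m` are treated at once because the
recursion reaches every earlier time. -/
theorem enorm_le_shockChain {D : ℤ → ℝ} {ω : Ω} {C : ℝ≥0∞} {k : ℤ} (hρ : 0 ≤ ρ)
    (hb : ∀ j, 1 ≤ j → 0 ≤ b j)
    (h : ∀ l, ‖D l‖ₑ ≤ ENNReal.ofReal (ξ l ω) *
      ∑' j : ℕ, ENNReal.ofReal (b (j + 1)) * ‖D (l - ((j : ℤ) + 1))‖ₑ)
    (hC : ∀ m : ℕ, ‖D (k - m)‖ₑ ≤ C * ENNReal.ofReal ρ ^ m) (n m : ℕ) :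
    ‖D (k - m)‖ₑ ≤ C * ENNReal.ofReal ρ ^ m * shockChain ξ b ρ n (k - m) ω := by
  induction n generalizing m with
  | zero => simpa [shockChain] using hC m
  | succ n ih =>
    refine (h _).trans ?_
    rw [shockChain, mul_left_comm, ← ENNReal.tsum_mul_left (a := C * ENNReal.ofReal ρ ^ m)]
    refine mul_le_mul_right (ENNReal.tsum_le_tsum fun j => ?_) _
    have h1 := ih (m + (j + 1))
    rw [show k - ((m + (j + 1) : ℕ) : ℤ) = k - m - ((j : ℤ) + 1) by push_cast; ring] at h1
    calc _ ≤ ENNReal.ofReal (b (j + 1)) * (C * ENNReal.ofReal ρ ^ (m + (j + 1)) *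
          shockChain ξ b ρ n (k - m - ((j : ℤ) + 1)) ω) := by gcongr
      _ = _ := by
        rw [ENNReal.ofReal_mul (hb _ (by omega)), ENNReal.ofReal_pow hρ, pow_add]
        ring

variable [MeasurableSpace Ω] {P : Measure Ω}

theorem covariance_congr_ae {X X' Y Y' : Ω → ℝ} (hX : X =ᵐ[P] X') (hY : Y =ᵐ[P] Y') :
    cov[X, Y; P] = cov[X', Y'; P] := by
  rw [covariance, covariance, integral_congr_ae hX, integral_congr_ae hY]
  refine integral_congr_ae ?_
  filter_upwards [hX, hY] with ω h1 h2
  rw [h1, h2]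

theorem innovation_ae_eq {lam a : ℝ} {X Y : ℤ → Ω → ℝ} (h : ∀ k, X k =ᵐ[P] Y k) (k : ℤ) :
    innovation lam a b X k =ᵐ[P] innovation lam a b Y k := by
  filter_upwards [ae_all_iff.2 h] with ω hω
  simp only [innovation, volatility, hω]

variable [IsProbabilityMeasure P]

namespace IsShock

/-- The shock at `k` is independent of the chains that start earlier, so every level contributes the
same factor. -/
theorem lintegral_shockChain (hξ : IsShock P ξ) (hb : ∀ j, 1 ≤ j → 0 ≤ b j) (hρ : 0 ≤ ρ)
    (hs : Summable fun j : ℕ => b (j + 1) * ρ ^ (j + 1)) (n : ℕ) (k : ℤ) :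
    ∫⁻ ω, shockChain ξ b ρ n k ω ∂P =
      ENNReal.ofReal ((∫ ω, ξ 0 ω ∂P) * ∑' j : ℕ, b (j + 1) * ρ ^ (j + 1)) ^ n := by
  induction n generalizing k with
  | zero => simp [shockChain]
  | succ n ih =>
    have hm := measurable_past_sum_of_shockChain
      (measurable_past_shockChain (ξ := ξ) (b := b) (ρ := ρ) n) k
    have hi : IndepFun (fun ω => ENNReal.ofReal (ξ k ω)) (fun ω => ∑' j : ℕ,
        ENNReal.ofReal (b (j + 1) * ρ ^ (j + 1)) *
          shockChain ξ b ρ n (k - ((j : ℤ) + 1)) ω) P :=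
      (hξ.indepFun_past hm).comp (φ := ENNReal.ofReal) (ψ := id) ENNReal.measurable_ofReal
        measurable_id
    have hc : ∀ l, Measurable (shockChain ξ b ρ n l) := fun l =>
      (measurable_past_shockChain n l).mono (hξ.past_le _) le_rfl
    simp only [shockChain]
    rw [lintegral_mul_eq_lintegral_mul_lintegral_of_indepFun''
      (hξ.measurable k).ennreal_ofReal.aemeasurable
      (hm.mono (hξ.past_le k) le_rfl).aemeasurable hi,
      lintegral_tsum fun j => ((hc _).const_mul _).aemeasurable,
      ← ofReal_integral_eq_lintegral_ofReal ((hξ.memLp_apply k).integrable one_le_two)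
        (hξ.nonneg k), hξ.integral_apply]
    simp only [lintegral_const_mul _ (hc _), ih]
    rw [ENNReal.tsum_mul_right, ← ENNReal.ofReal_tsum_of_nonneg
      (fun j => mul_nonneg (hb _ (by omega)) (by positivity)) hs, ← mul_assoc,
      ← ENNReal.ofReal_mul hξ.mean_pos.le, pow_succ, mul_comm]

/-- The expectations form a convergent geometric series, so almost surely the chains are summable in
`n`. -/
theorem ae_tendsto_shockChain (hξ : IsShock P ξ) (hb : ∀ j, 1 ≤ j → 0 ≤ b j) (hρ : 0 ≤ ρ)
    (hs : Summable fun j : ℕ => b (j + 1) * ρ ^ (j + 1))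
    (hlt : (∫ ω, ξ 0 ω ∂P) * ∑' j : ℕ, b (j + 1) * ρ ^ (j + 1) < 1) (k : ℤ) :
    ∀ᵐ ω ∂P, Tendsto (fun n => shockChain ξ b ρ n k ω) atTop (𝓝 0) := by
  have hc : ∀ n, AEMeasurable (shockChain ξ b ρ n k) P := fun n =>
    ((measurable_past_shockChain n k).mono (hξ.past_le _) le_rfl).aemeasurable
  have h1 : ∫⁻ ω, ∑' n, shockChain ξ b ρ n k ω ∂P ≠ ⊤ := by
    rw [lintegral_tsum hc]
    simp only [hξ.lintegral_shockChain hb hρ hs]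
    rw [ENNReal.tsum_geometric]
    exact ENNReal.inv_ne_top.2 (tsub_pos_of_lt (ENNReal.ofReal_lt_one.2 hlt)).ne'
  filter_upwards [ae_lt_top' (AEMeasurable.tsum hc) h1] with ω hω
  exact ENNReal.tendsto_atTop_zero_of_tsum_ne_top hω.ne

end IsShock

theorem IsWeaklyStationary.exists_integral_norm_le {X : ℤ → Ω → ℝ}
    (hX : IsWeaklyStationary P X) : ∃ c, ∀ k, ∫ ω, ‖X k ω‖ ∂P ≤ c := by
  refine ⟨1 + (autocov P X 0 + (∫ ω, X 0 ω ∂P) * ∫ ω, X 0 ω ∂P), fun k => ?_⟩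
  have h1 := hX.cov k 0
  rw [add_zero, covariance_eq_sub (hX.memLp k) (hX.memLp k), hX.mean k] at h1
  rw [← h1, sub_add_cancel]
  have hi := (hX.memLp k).integrable_mul (hX.memLp k)
  have h2 : ∫ _, (1 : ℝ) ∂P = 1 := by simp
  rw [← h2, ← integral_add (integrable_const _) hi]
  refine integral_mono ((hX.memLp k).integrable one_le_two).norm
    ((integrable_const _).add hi) fun ω => ?_
  simp only [Pi.mul_apply, Real.norm_eq_abs]
  nlinarith [sq_nonneg (|X k ω| - 1), sq_abs (X k ω), abs_nonneg (X k ω)]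

/-- Weakly stationary solutions of the ARCH(∞) equations are unique, even without assuming that
they are causal. -/
theorem SolvesArch.ae_eq {a r : ℝ} {X Y : ℤ → Ω → ℝ} (hξ : IsShock P ξ)
    (hb : ∀ j, 1 ≤ j → 0 ≤ b j) (hr0 : 0 < r) (hr1 : r < 1)
    (hs : Summable fun j : ℕ => b (j + 1) * r⁻¹ ^ (j + 1))
    (hlt : (∫ ω, ξ 0 ω ∂P) * ∑' j : ℕ, b (j + 1) * r⁻¹ ^ (j + 1) < 1)
    (hX : IsWeaklyStationary P X) (hY : IsWeaklyStationary P Y)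
    (hX' : SolvesArch P ξ a b X) (hY' : SolvesArch P ξ a b Y) (k : ℤ) : X k =ᵐ[P] Y k := by
  obtain ⟨c, hc⟩ := hX.exists_integral_norm_le
  obtain ⟨d, hd⟩ := hY.exists_integral_norm_le
  have hXi : ∀ k, Integrable (X k) P := fun k => (hX.memLp k).integrable one_le_two
  have hYi : ∀ k, Integrable (Y k) P := fun k => (hY.memLp k).integrable one_le_two
  -- Bounded first moments make this series converge almost surely, which is all that is needed of
  -- the two solutions: independence is used only for the chains of shocks.
  have hsum : ∀ᵐ ω ∂P, Summable fun m : ℕ => r ^ m * (X (k - m) ω - Y (k - m) ω) := by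
    refine ae_summable_of_integral_norm_le (C := fun m => r ^ m * (c + d))
      (fun m => ((hXi _).sub (hYi _)).const_mul _) (fun m => ?_)
      ((summable_geometric_of_lt_one hr0.le hr1).mul_right _)
    simp only [norm_mul, norm_pow, Real.norm_of_nonneg hr0.le, integral_const_mul]
    gcongr
    calc ∫ ω, ‖X (k - m) ω - Y (k - m) ω‖ ∂P
        ≤ ∫ ω, (‖X (k - m) ω‖ + ‖Y (k - m) ω‖) ∂P :=
          integral_mono ((hXi _).sub (hYi _)).norm ((hXi _).norm.add (hYi _).norm)
            fun ω => norm_sub_le _ _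
      _ ≤ c + d := by
          rw [integral_add (hXi _).norm (hYi _).norm]
          exact add_le_add (hc _) (hd _)
  filter_upwards [hsum, hX', hY', hξ.ae_nonneg,
    hξ.ae_tendsto_shockChain hb (inv_pos.2 hr0).le hs hlt k] with ω h1 h2 h3 h4 h5
  set D : ℤ → ℝ := fun l => X l ω - Y l ω with hD
  have hrec : ∀ l, ‖D l‖ₑ ≤ ENNReal.ofReal (ξ l ω) *
      ∑' j : ℕ, ENNReal.ofReal (b (j + 1)) * ‖D (l - ((j : ℤ) + 1))‖ₑ := by
    intro l
    have e1 : D l = ξ l ω * ∑' j : ℕ, b (j + 1) * D (l - ((j : ℤ) + 1)) := by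
      have e2 : ∑' j : ℕ, b (j + 1) * D (l - ((j : ℤ) + 1)) =
          ∑' j : ℕ, b (j + 1) * X (l - ((j : ℤ) + 1)) ω -
            ∑' j : ℕ, b (j + 1) * Y (l - ((j : ℤ) + 1)) ω := by
        rw [← (h2 l).1.tsum_sub (h3 l).1]
        simp only [hD, mul_sub]
      rw [e2, hD]
      simp only
      rw [(h2 l).2, (h3 l).2, volatility, volatility]
      ring
    rw [e1, enorm_mul, Real.enorm_of_nonneg (h4 l)]
    gcongr
    refine enorm_tsum_le_tsum_enorm.trans (ENNReal.tsum_le_tsum fun j => ?_)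
    rw [enorm_mul, Real.enorm_of_nonneg (hb _ (by omega))]
  -- The constant depends on `ω`, which is harmless since the rest of the argument is pathwise.
  obtain ⟨C, hC⟩ := h1.tendsto_atTop_zero.norm.bddAbove_range
  have hCb : ∀ m : ℕ, ‖D (k - m)‖ₑ ≤ ENNReal.ofReal C * ENNReal.ofReal r⁻¹ ^ m := by
    intro m
    have h6 : ‖r ^ m * D (k - m)‖ ≤ C := hC (Set.mem_range_self m)
    have hC0 : 0 ≤ C := (norm_nonneg _).trans h6
    rw [← ENNReal.ofReal_pow (inv_pos.2 hr0).le, ← ENNReal.ofReal_mul hC0, ← ofReal_norm]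
    refine ENNReal.ofReal_le_ofReal ?_
    rw [norm_mul, norm_pow, Real.norm_of_nonneg hr0.le] at h6
    rw [inv_pow, ← div_eq_mul_inv, le_div_iff₀ (by positivity), mul_comm]
    exact h6
  have h7 := fun n => enorm_le_shockChain (inv_pos.2 hr0).le hb hrec hCb n 0
  simp only [Nat.cast_zero, sub_zero, pow_zero, mul_one] at h7
  have h8 : Tendsto (fun n => ENNReal.ofReal C * shockChain ξ b r⁻¹ n k ω) atTop (𝓝 0) := by
    simpa using ENNReal.Tendsto.const_mul h5 (Or.inr ENNReal.ofReal_ne_top)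
  have h9 : ‖D k‖ₑ ≤ 0 := ge_of_tendsto' h8 h7
  exact sub_eq_zero.1 (enorm_eq_zero.1 (le_antisymm h9 bot_le))

end

end ArchInfinity

/-! ### Existence and autocovariance asymptotics. -/

open ArchInfinity in
theorem theorem4p4 {Ω : Type*} [MeasurableSpace Ω] (P : Measure Ω) [IsProbabilityMeasure P]
    (ξ : ℤ → Ω → ℝ) (hξ : ArchInfinity.IsShock P ξ)
    (lam sigma : ℝ) (hlam : lam = ∫ ω, ξ 0 ω ∂P) (hsigma : sigma = Real.sqrt (Var[ξ 0; P]))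
    (a : ℝ) (ha : 0 < a)
    (b : ℕ → ℝ) (hb : ∀ j, 1 ≤ j → 0 ≤ b j) (hb_ne : ∃ j, 1 ≤ j ∧ b j ≠ 0)
    (r : ℝ) (hr0 : 0 < r) (hr1 : r < 1)
    (hS2 : ArchInfinity.bigOmega lam sigma b < 1)
    (hsum : Summable (fun j : ℕ => b (j + 1) * r⁻¹ ^ (j + 1)))
    (hlt : lam * ∑' j : ℕ, b (j + 1) * r⁻¹ ^ (j + 1) < 1) :
    (∃ X : ℤ → Ω → ℝ,
      ArchInfinity.IsWeaklyStationary P X ∧ ArchInfinity.SolvesArch P ξ a b X) ∧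
    (ArchInfinity.MemW r b →
      ∀ X : ℤ → Ω → ℝ,
        ArchInfinity.IsWeaklyStationary P X → ArchInfinity.SolvesArch P ξ a b X →
          ArchInfinity.MemW r (fun n : ℕ => ArchInfinity.autocov P X (n : ℤ)) ∧
          Integrable (fun ω => ArchInfinity.innovation lam a b X 0 ω ^ 2) P ∧
          Tendsto (fun n : ℕ => ArchInfinity.autocov P X (n : ℤ) / b n) atTop
            (𝓝 ((∫ ω, ArchInfinity.innovation lam a b X 0 ω ^ 2 ∂P) /
                  (1 - lam * ∑' j : ℕ, b (j + 1) * r ^ (j + 1)) *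
                (lam / (1 - lam * ∑' j : ℕ, b (j + 1) * r⁻¹ ^ (j + 1)) ^ 2)))) := by
  have hl : 0 < lam := hlam ▸ hξ.mean_pos
  have hone : (1 : ℝ) ≤ r⁻¹ := (one_le_inv₀ hr0).2 hr1.le
  have hbs : Summable fun j : ℕ => b (j + 1) := by
    simpa using summable_of_le_pow hb zero_le_one hone hsum
  have hz := summable_resolvent hl.le hr0 hr1 hb hsum hlt
  obtain ⟨C, hC⟩ := hξ.exists_volSq_le hlam ha.le hb hz (hsigma ▸ hS2)
  obtain ⟨v, hv⟩ : ∃ v, Tendsto (volSq P ξ a b) atTop (𝓝 v) :=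
    ⟨_, tendsto_atTop_ciSup (hξ.monotone_volSq ha.le hb)
      ⟨C, by rintro _ ⟨n, rfl⟩; exact hC n⟩⟩
  have hS := hξ.isWeaklyStationary_archSol ha.le hb hlam hz hbs hv
  have hS' := hξ.solvesArch_archSol ha.le hb (hlam ▸ hz) hbs
  refine ⟨⟨_, hS, hS'⟩, fun hW X hX hX' => ?_⟩
  have hae : ∀ k, X k =ᵐ[P] archSol ξ a b k :=
    SolvesArch.ae_eq hξ hb hr0 hr1 hsum (hlam ▸ hlt) hX hS hX' hS'
  have hin : (fun ω => innovation lam a b X 0 ω ^ 2) =ᵐ[P]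
      fun ω => innovation lam a b (archSol ξ a b) 0 ω ^ 2 :=
    (innovation_ae_eq (lam := lam) (a := a) (b := b) hae 0).mono fun ω h => by simp only [h]
  obtain ⟨hi1, hi2⟩ := hξ.integral_innovation_sq ha.le hb hlam hz hbs hv 0
  have hcov : ∀ n : ℕ, autocov P X n =
      Var[ξ 0; P] * v * ∑' j, resolvent lam b j * resolvent lam b (j + n) := fun n => by
    have h := hξ.cov_archSol ha.le hb hlam hz hbs hv 0 n
    rw [zero_add] at h
    rw [autocov, covariance_congr_ae (hae 0) (hae n), h]
  -- This is `E[ν(0)²]`. It is positive because the volatility is at least `a > 0`, and membership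
  -- of the autocovariances in `𝒲(r)` needs a positive limit.
  have hV : 0 < Var[ξ 0; P] * v := by
    have h1 : a ^ 2 ≤ v := ge_of_tendsto' hv fun n => hξ.sq_le_volSq n ha.le hb
    have h2 := hξ.variance_pos
    have h3 : 0 < v := lt_of_lt_of_le (by positivity) h1
    positivity
  have hlim : Tendsto (fun n : ℕ => autocov P X (n : ℤ) / b n) atTop
      (𝓝 (Var[ξ 0; P] * v / (1 - lam * ∑' j : ℕ, b (j + 1) * r ^ (j + 1)) *
        (lam / (1 - lam * ∑' j : ℕ, b (j + 1) * r⁻¹ ^ (j + 1)) ^ 2))) := by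
    have h := (tendsto_tsum_resolvent_div hl hr0 hr1 hW hsum hlt).const_mul (Var[ξ 0; P] * v)
    rw [← mul_assoc, mul_one_div] at h
    refine h.congr fun n => ?_
    rw [hcov, mul_div_assoc]
  have hlt' := mul_tsum_lt_one hl.le hb hr0.le (hr1.le.trans hone) hsum hlt
  have hz0 := resolvent_pos hl hW.pos
  refine ⟨hW.of_tendsto_div hr0 ?_ (fun n => ?_) hlim, hi1.congr hin.symm, ?_⟩
  · have h1 : 0 < 1 - lam * ∑' j : ℕ, b (j + 1) * r ^ (j + 1) := by linarith
    have h2 : 0 < 1 - lam * ∑' j : ℕ, b (j + 1) * r⁻¹ ^ (j + 1) := by linarith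
    positivity
  · rw [hcov]
    have hs2 : Summable fun j => resolvent lam b j * resolvent lam b (j + n) :=
      Summable.of_nonneg_of_le (fun j => (mul_pos (hz0 _) (hz0 _)).le)
        (fun j => mul_le_mul_of_nonneg_left (hz.le_tsum _ fun i _ => (hz0 i).le) (hz0 j).le)
        (hz.mul_right _)
    exact mul_pos hV (hs2.tsum_pos (fun j => (mul_pos (hz0 _) (hz0 _)).le) 0
      (mul_pos (hz0 _) (hz0 _)))
  · rw [integral_congr_ae hin, hi2]
    exact hlim
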